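/- **Setting.** Let $(L,v_L)/(K,v_K)$ be an extension of valued fields, with valuations written additively and taking values in $\mathbb{R}\cup\{\infty\}$; let $K^\circ=\{v_K\ge 0\}$ and $L^\circ=\{v_L\ge 0\}$ be the unit balls. Let $\Omega^{\log}_{L^\circ/K^\circ}$ be the module of log differentials of $(K^\circ\setminus\{0\}\to K^\circ)\to(L^\circ\setminus\{0\}\to L^\circ)$, i.e. the $L^\circ$-module generated by symbols $\mathrm{d}b$ ($b\in L^\circ$) and $\mathrm{dlog}\,q$ ($q\in L^\circ\setminus\{0\}$), subject to the relations of $\Omega_{L^\circ/K^\circ}$, $\mathrm{d}q=q\,\mathrm{dlog}\,q$, $\mathrm{dlog}(qq')=\mathrm{dlog}\,q+\mathrm{dlog}\,q'$, and $\mathrm{dlog}\,p=0$ for $p\in K^\circ\setminus\{0\}$. The *content* of a finitely presented $L^\circ$-module $M\simeq\bigoplus_{i=1}^n L^\circ/(\alpha_i)$ is $\operatorname{cont}(M)=\sum_i v_L(\alpha_i)\in[0,\infty]$; if $M$ is not finitely presented, $\operatorname{cont}(M)$ is the supremum of the contents of the finitely presented subquotients of $M$. For $\omega\in\Omega^{\log}_{L^\circ/K^\circ}$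 put $$\operatorname{disc}^{\log}\omega=\operatorname{cont}\bigl(\Omega^{\log}_{L^\circ/K^\circ}/L^\circ\omega\bigr),$$ and let $\omega_L$ be its image under the map $\Omega^{\log}_{L^\circ/K^\circ}\to\Omega_{L/K}$ with $\mathrm{d}b\mapsto\mathrm{d}b$, $\mathrm{dlog}\,q\mapsto q^{-1}\mathrm{d}q$. The *Kähler valuation* $v_\Omega$ on $\Omega_{L/K}$ is the smallest map $u:\Omega_{L/K}\to\mathbb{R}\cup\{\infty\}$ with $u(a+b)\ge\min\{u(a),u(b)\}$, $u(ca)=v_L(c)+u(a)$ for $c\in L$, and $u(\mathrm{d}b)\ge v_L(b)$ for all $b\in L$. The *(absolute) log different* of $L/K$ is $$\mathfrak{d}^{\mathrm{abs},\log}_{L/K}=\operatorname{cont}\bigl((\Omega^{\log}_{L^\circ/K^\circ})_{\mathrm{tor}}\bigr)$$ if $L/K$ is separable, and $\infty$ otherwise. Here $L/K$ is *separable* if $L$ is geometrically reduced over $K$. **Proposition.** Let $L/K$ be separable of transcendence degree $1$ with $\Omega_{L/K}\neq 0$ (the last condition is automatic if $L/K$ is finitely generated, e.g. if $L=K(T)$).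 Then for every $\omega\in\Omega^{\log}_{L^\circ/K^\circ}$ $$\operatorname{disc}^{\log}\omega=v_\Omega(\omega_L)+\mathfrak{d}^{\mathrm{abs},\log}_{L/K}$$ in $[0,\infty]$. -/

import Mathlib

open scoped KaehlerDifferential

noncomputable section

namespace LogDiff

/-! ### Real valued fields

A real valuation on a field `F`, written additively, is an `AddValuation F (WithTop ℝ)`:
`v x = ∞` exactly for `x = 0`. -/

/-- The inclusion of `(-∞, ∞]` into the extended real numbers. -/
def toEReal (x : WithTop ℝ) : EReal := WithBot.some x

section Fields

variable {K L : Type*} [Field K] [Field L] [Algebra K L]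

/-- The unit ball `F° = {x | 0 ≤ v x}` of a valued field, as a valuation subring. -/
def unitBall (v : AddValuation K (WithTop ℝ)) : ValuationSubring K where
  carrier := {x | 0 ≤ v x}
  mul_mem' {x y} hx hy := by
    change 0 ≤ v (x * y)
    rw [v.map_mul]
    exact add_nonneg hx hy
  one_mem' := by
    change 0 ≤ v 1
    rw [v.map_one]
  add_mem' {x y} hx hy := le_trans (le_min hx hy) (v.map_add x y)
  zero_mem' := by
    change 0 ≤ v 0
    rw [v.map_zero]
    exact le_top
  neg_mem' {x} hx := by
    change 0 ≤ v (-x)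
    rw [v.map_neg]
    exact hx
  mem_or_inv_mem' x := by
    change 0 ≤ v x ∨ 0 ≤ v x⁻¹
    by_cases hx : x = 0
    · left
      rw [hx, v.map_zero]
      exact le_top
    · have h : v x + v x⁻¹ = 0 := by rw [← v.map_mul, mul_inv_cancel₀ hx, v.map_one]
      by_contra! hc
      have h2 : v x + v x⁻¹ < 0 := by
        calc v x + v x⁻¹ ≤ v x + 0 := by gcongr; exact hc.2.le
          _ = v x := add_zero _
          _ < 0 := hc.1
      exact absurd h h2.ne

/-- `(L, vL) / (K, vK)` is an extension of valued fields: `vL` restricts to `vK`. -/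
class IsValuedExtension (vK : AddValuation K (WithTop ℝ)) (vL : AddValuation L (WithTop ℝ)) :
    Prop where
  map_eq : ∀ x : K, vL (algebraMap K L x) = vK x

/-- The `K°`-algebra structure on `L°`. -/
instance algebraUnitBall (vK : AddValuation K (WithTop ℝ)) (vL : AddValuation L (WithTop ℝ))
    [h : IsValuedExtension vK vL] : Algebra (unitBall vK) (unitBall vL) :=
  RingHom.toAlgebra
    { toFun := fun x => ⟨algebraMap K L x, by
        change 0 ≤ vL (algebraMap K L x)
        rw [h.map_eq]
        exact x.2⟩
      map_one' := Subtype.ext (map_one (algebraMap K L))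
      map_mul' := fun x y => Subtype.ext (map_mul (algebraMap K L) (x : K) (y : K))
      map_zero' := Subtype.ext (map_zero (algebraMap K L))
      map_add' := fun x y => Subtype.ext (map_add (algebraMap K L) (x : K) (y : K)) }

theorem coe_algebraMap_unitBall (vK : AddValuation K (WithTop ℝ))
    (vL : AddValuation L (WithTop ℝ)) [IsValuedExtension vK vL] (x : unitBall vK) :
    ((algebraMap (unitBall vK) (unitBall vL) x : unitBall vL) : L) = algebraMap K L (x : K) :=
  rfl

end Fields

/-! ### Content -/

section Content

variable {F : Type*} [Field F] (v : AddValuation F (WithTop ℝ))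
variable (M : Type*) [AddCommGroup M] [Module (unitBall v) M]

/-- The content of a finitely presented `F°`-module `M`: it is `∑ v (αᵢ)` for any isomorphism
`M ≃ ⨁ F° / (αᵢ)`. (Such an isomorphism exists, and the sum does not depend on it, so that the
supremum is over a single value.) -/
def contentFP : EReal :=
  ⨆ (n : ℕ) (α : Fin n → unitBall v)
    (_ : Nonempty (M ≃ₗ[unitBall v] ((i : Fin n) → unitBall v ⧸ Ideal.span {α i}))),
    ∑ i, toEReal (v (α i : F))

open Classical in
/-- The content of an `F°`-module: as above if it is finitely presented, and otherwise the
supremum of the contents of its finitely presented subquotients `N / P`. -/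
def content : EReal :=
  if Module.FinitePresentation (unitBall v) M then contentFP v M
  else ⨆ (N : Submodule (unitBall v) M) (P : Submodule (unitBall v) N)
    (_ : Module.FinitePresentation (unitBall v) (N ⧸ P)), contentFP v (N ⧸ P)

end Content

/-! ### Log differentials -/

section LogDifferentials

variable (A B : Type*) [CommRing A] [CommRing B] [Algebra A B]
variable (P : Submonoid A) (Q : Submonoid B)

/-- The relations between the symbols `db` and `dlog q` (the second being `Finsupp.single q 1`):
`d q = q dlog q`, `dlog (q q') = dlog q + dlog q'`, and `dlog q = 0` if `q` is the image of an
element of `P`. -/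
def logRelations : Submodule B (Ω[B⁄A] × (Q →₀ B)) :=
  Submodule.span B
    ({x | ∃ q : Q, x = (KaehlerDifferential.D A B (q : B), -Finsupp.single q (q : B))} ∪
     {x | ∃ q q' : Q, x = (0, Finsupp.single (q * q') 1 - Finsupp.single q 1
        - Finsupp.single q' 1)} ∪
     {x | ∃ q : Q, ∃ p ∈ P, algebraMap A B p = (q : B) ∧ x = (0, Finsupp.single q 1)})

/-- The module of log differentials of the log rings `(P ↪ A) → (Q ↪ B)`, where `P` and `Q`
are multiplicative submonoids of `A` and `B`. -/
abbrev LogDifferentials : Type _ := (Ω[B⁄A] × (Q →₀ B)) ⧸ logRelations A B P Q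

end LogDifferentials

/-! ### The invariants of an extension of valued fields -/

section Invariants

variable {K L : Type*} [Field K] [Field L] [Algebra K L]
variable (vK : AddValuation K (WithTop ℝ)) (vL : AddValuation L (WithTop ℝ))
variable [IsValuedExtension vK vL]

/-- `Ω^log` of `L° / K°`, both rings with their total log structures `L° \ {0}`, `K° \ {0}`. -/
abbrev IntegralLogDifferentials : Type _ :=
  LogDifferentials (unitBall vK) (unitBall vL)
    (nonZeroDivisors (unitBall vK)) (nonZeroDivisors (unitBall vL))

instance isScalarTower_unitBall : IsScalarTower (unitBall vK) (unitBall vL) Ω[L⁄K] :=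
  ⟨fun a b m => by
    rw [Algebra.smul_def, mul_smul]
    exact algebraMap_smul L (a : K) (b • m)⟩

/-- The natural map `Ω_{L°/K°} → Ω_{L/K}`, `db ↦ db`. -/
def kaehlerToField : Ω[unitBall vL⁄unitBall vK] →ₗ[unitBall vL] Ω[L⁄K] :=
  Derivation.liftKaehlerDifferential
    { toFun := fun b => KaehlerDifferential.D K L (b : L)
      map_add' := fun a b => by simp
      map_smul' := fun a b => by
        rw [Algebra.smul_def]
        change KaehlerDifferential.D K L (algebraMap K L (a : K) * (b : L)) =
          (a : K) • KaehlerDifferential.D K L (b : L)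
        simp
      map_one_eq_zero' := by simp
      leibniz' := fun a b => by
        change KaehlerDifferential.D K L ((a : L) * (b : L)) =
          (a : L) • KaehlerDifferential.D K L (b : L) + (b : L) • KaehlerDifferential.D K L (a : L)
        simp }

theorem kaehlerToField_D (b : unitBall vL) :
    kaehlerToField vK vL (KaehlerDifferential.D (unitBall vK) (unitBall vL) b) =
      KaehlerDifferential.D K L (b : L) := by
  unfold kaehlerToField
  rw [Derivation.liftKaehlerDifferential_comp_D]
  rfl

/-- `db ↦ db` and `dlog q ↦ q⁻¹ dq`, before dividing out the relations. -/
def preLogToField : (Ω[unitBall vL⁄unitBall vK] × (nonZeroDivisors (unitBall vL) →₀ unitBall vL))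
    →ₗ[unitBall vL] Ω[L⁄K] :=
  (kaehlerToField vK vL).coprod
    (Finsupp.linearCombination (unitBall vL) fun q : nonZeroDivisors (unitBall vL) =>
      (((q : unitBall vL) : L)⁻¹) • KaehlerDifferential.D K L ((q : unitBall vL) : L))

theorem logRelations_le_ker :
    logRelations (unitBall vK) (unitBall vL) (nonZeroDivisors (unitBall vK))
      (nonZeroDivisors (unitBall vL)) ≤ LinearMap.ker (preLogToField vK vL) := by
  have hne : ∀ q : nonZeroDivisors (unitBall vL), ((q : unitBall vL) : L) ≠ 0 := fun q h =>
    nonZeroDivisors.coe_ne_zero q (Subtype.ext h)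
  refine Submodule.span_le.2 ?_
  rintro x ((⟨q, rfl⟩ | ⟨q, q', rfl⟩) | ⟨q, p, -, hp, rfl⟩)
  · have h : (q : unitBall vL) • ((((q : unitBall vL) : L)⁻¹) •
        KaehlerDifferential.D K L ((q : unitBall vL) : L)) =
        KaehlerDifferential.D K L ((q : unitBall vL) : L) := by
      change ((q : unitBall vL) : L) • ((((q : unitBall vL) : L)⁻¹) •
        KaehlerDifferential.D K L ((q : unitBall vL) : L)) = _
      rw [smul_smul, mul_inv_cancel₀ (hne q), one_smul]
    simp [preLogToField, kaehlerToField_D, h]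
  · have h1 := hne q
    have h2 := hne q'
    simp only [preLogToField, SetLike.mem_coe, LinearMap.mem_ker, LinearMap.coprod_apply,
      map_zero, zero_add, map_sub, Finsupp.linearCombination_single, one_smul,
      MulMemClass.coe_mul, Derivation.leibniz, smul_add, smul_smul, mul_inv]
    have e1 : (((q : unitBall vL) : L)⁻¹ * ((q' : unitBall vL) : L)⁻¹) * ((q : unitBall vL) : L)
      = ((q' : unitBall vL) : L)⁻¹ := by field_simp
    have e2 : (((q : unitBall vL) : L)⁻¹ * ((q' : unitBall vL) : L)⁻¹) * ((q' : unitBall vL) : L)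
      = ((q : unitBall vL) : L)⁻¹ := by field_simp
    rw [e1, e2]
    abel
  · have h : ((q : unitBall vL) : L) = algebraMap K L (p : K) := by
      rw [← hp, coe_algebraMap_unitBall]
    simp [preLogToField, h]

/-- The natural map `Ω^log_{L°/K°} → Ω_{L/K}`, `ω ↦ ω_L`. -/
def toFieldDifferential : IntegralLogDifferentials vK vL →ₗ[unitBall vL] Ω[L⁄K] :=
  (logRelations (unitBall vK) (unitBall vL) (nonZeroDivisors (unitBall vK))
    (nonZeroDivisors (unitBall vL))).liftQ (preLogToField vK vL) (logRelations_le_ker vK vL)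

/-- The log discrepancy of `ω`: the content of `Ω^log_{L°/K°} / (L° ω)`. -/
def logDiscrepancy (ω : IntegralLogDifferentials vK vL) : EReal :=
  content vL (IntegralLogDifferentials vK vL ⧸ Submodule.span (unitBall vL) {ω})

open Classical in
/-- The (absolute) log different of `L / K`: the content of the torsion of `Ω^log_{L°/K°}`
if `L / K` is separable (i.e. geometrically reduced), and `∞` otherwise. -/
def absLogDifferent : EReal :=
  if Algebra.IsGeometricallyReduced K L then
    content vL (Submodule.torsion (unitBall vL) (IntegralLogDifferentials vK vL))
  else ⊤

end Invariants

section KaehlerValuation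

variable (K : Type*) {L : Type*} [Field K] [Field L] [Algebra K L]

/-- A semi-valuation `u` on a module over a valued field `(L, v)`. -/
structure IsSemivaluation {M : Type*} [AddCommGroup M] [Module L M]
    (v : AddValuation L (WithTop ℝ)) (u : M → WithTop ℝ) : Prop where
  min_le_add : ∀ a b : M, min (u a) (u b) ≤ u (a + b)
  smul : ∀ (c : L) (a : M), u (c • a) = v c + u a

/-- The Kähler semi-valuation on `Ω_{L/K}`: the minimal semi-valuation `u` such that
`u (db) ≥ v b` for all `b`. The minimal one is the pointwise infimum (which is again such a
semi-valuation, since `u (∑ aᵢ dbᵢ) ≥ min (v aᵢ + v bᵢ)` for all of them). -/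
def kaehlerValuation (v : AddValuation L (WithTop ℝ)) (ω : Ω[L⁄K]) : EReal :=
  ⨅ (u : Ω[L⁄K] → WithTop ℝ) (_ : IsSemivaluation v u)
    (_ : ∀ b : L, v b ≤ u (KaehlerDifferential.D K L b)), toEReal (u ω)

end KaehlerValuation

end LogDiff

end

/-! Write `J` for the image of the log differentials in `Ω[L⁄K]`. The kernel of the map onto `J` is
exactly the torsion: clearing the denominators of the `dlog q` leaves a Kähler differential, and
Kähler differentials localise. If `ω_L ≠ 0`, then `L°ω` meets the torsion trivially, so `0 → Ω_tor →
Ω/L°ω → J/L°ω_L → 0` is exact, where `Ω` denotes the log differentials. Additivity of the content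
reduces the claim to `cont(J/L°ω_L) = v_Ω(ω_L)`. Separability, transcendence degree one and `Ω[L⁄K]
≠ 0` make `Ω[L⁄K]` a line (`exists_kaehlerDifferential_generator`), so the cyclic submodules of `J`
form a chain, and the content is the supremum of `v a` over all factorisations `ω_L = a • y` with `y
∈ J` (`relLength_span_singleton`). As `J` is spanned by the elements `b⁻¹ db`, this supremum is the
Kähler valuation (`kaehlerValuation_eq_iSup`). If `ω_L = 0`, both sides are infinite.

The delicate point is additivity of the content for arbitrary modules over a possibly non-discrete
valuation ring. It is proved for a substitute, `valLength`, a weighted length: adjoining `x` to `N`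
costs the infimum of `v` on the conductor `(N : x)`, and one takes the supremum over finite chains.
Additivity is then an argument on chains (`valLength_eq_add`). Smith normal form and almost finite
generation of submodules of free modules identify it with the content (`content_eq_valLength`). -/

noncomputable section

namespace LogDiff

open scoped ENNReal

/-! ### A weighted length for modules over the unit ball, and its additivity. -/

section Length

variable {F : Type*} [Field F] (v : AddValuation F (WithTop ℝ))

/-- The valuation on the unit ball, as a function to `[0, ∞]`. -/
def ballVal (a : unitBall v) : ℝ≥0∞ := (toEReal (v (a : F))).toENNReal

theorem toEReal_nonneg {x : WithTop ℝ} (hx : 0 ≤ x) : 0 ≤ toEReal x := by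
  induction x using WithTop.recTopCoe with
  | top => exact le_top
  | coe r =>
    have h : (0 : ℝ) ≤ r := by exact_mod_cast hx
    exact EReal.coe_nonneg.2 h

@[simp] theorem toEReal_top : toEReal ⊤ = ⊤ := rfl

@[simp] theorem toEReal_coe (r : ℝ) : toEReal (r : WithTop ℝ) = (r : EReal) := rfl

@[simp] theorem toEReal_zero : toEReal 0 = 0 := rfl

theorem toEReal_add (x y : WithTop ℝ) : toEReal (x + y) = toEReal x + toEReal y := by
  induction x using WithTop.recTopCoe with
  | top =>
    induction y using WithTop.recTopCoe with
    | top => rfl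
    | coe s => simp
  | coe r =>
    induction y using WithTop.recTopCoe with
    | top => simp
    | coe s => rw [← WithTop.coe_add, toEReal_coe, toEReal_coe, toEReal_coe, EReal.coe_add]

theorem toEReal_le_toEReal {x y : WithTop ℝ} : toEReal x ≤ toEReal y ↔ x ≤ y := by
  induction x using WithTop.recTopCoe with
  | top =>
    induction y using WithTop.recTopCoe with
    | top => simp
    | coe s => simp
  | coe r =>
    induction y using WithTop.recTopCoe with
    | top => simp
    | coe s => simp

theorem coe_ballVal (a : unitBall v) : (ballVal v a : EReal) = toEReal (v (a : F)) :=
  EReal.coe_toENNReal (toEReal_nonneg a.2)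

@[simp] theorem ballVal_mul (a b : unitBall v) : ballVal v (a * b) = ballVal v a + ballVal v b := by
  rw [ballVal, ballVal, ballVal, ← EReal.toENNReal_add (toEReal_nonneg a.2) (toEReal_nonneg b.2),
    ← toEReal_add]
  congr 2
  exact v.map_mul _ _

@[simp] theorem ballVal_zero : ballVal v 0 = ⊤ := by
  simp [ballVal]

@[simp] theorem ballVal_one : ballVal v 1 = 0 := by
  simp [ballVal]

theorem ballVal_le_ballVal {a b : unitBall v} :
    ballVal v a ≤ ballVal v b ↔ v (a : F) ≤ v (b : F) := by
  rw [← EReal.coe_ennreal_le_coe_ennreal_iff, coe_ballVal, coe_ballVal, toEReal_le_toEReal]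

theorem ballVal_eq_top {a : unitBall v} : ballVal v a = ⊤ ↔ a = 0 := by
  refine ⟨fun h => ?_, fun h => h ▸ ballVal_zero v⟩
  have h1 : v ((0 : unitBall v) : F) ≤ v (a : F) := by
    rw [← ballVal_le_ballVal, h]; exact le_top
  have h2 : v (a : F) = ⊤ := top_le_iff.1 (by simpa using h1)
  exact Subtype.ext ((v.top_iff).1 h2)

theorem dvd_iff_ballVal_le {a b : unitBall v} : a ∣ b ↔ ballVal v a ≤ ballVal v b := by
  constructor
  · rintro ⟨c, rfl⟩
    simp
  · intro h
    by_cases ha : a = 0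
    · subst ha
      rw [ballVal_zero, top_le_iff, ballVal_eq_top] at h
      rw [h]
    · have ha' : (a : F) ≠ 0 := fun h => ha (Subtype.ext h)
      rw [ballVal_le_ballVal] at h
      have hc : (b : F) / a ∈ unitBall v := by
        change 0 ≤ v ((b : F) / a)
        have h3 : v ((b : F) / a) + v (a : F) = v (b : F) := by
          rw [← v.map_mul, div_mul_cancel₀ _ ha']
        have h4 : v (a : F) ≠ ⊤ := fun h => ha' ((v.top_iff).1 h)
        rw [← h3] at h
        by_contra! hlt
        refine absurd h (not_le.2 ?_)
        obtain ⟨r, hr⟩ := WithTop.ne_top_iff_exists.1 h4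
        obtain ⟨s, hs⟩ := WithTop.ne_top_iff_exists.1 hlt.ne_top
        rw [← hs, ← WithTop.coe_zero, WithTop.coe_lt_coe] at hlt
        rw [← hr, ← hs, ← WithTop.coe_add, WithTop.coe_lt_coe]
        linarith
      exact ⟨⟨_, hc⟩, Subtype.ext (mul_div_cancel₀ _ ha').symm⟩

variable {M M' M'' : Type*} [AddCommGroup M] [Module (unitBall v) M]
  [AddCommGroup M'] [Module (unitBall v) M'] [AddCommGroup M''] [Module (unitBall v) M'']

/-- The infimum of the valuation on the conductor of `x` to `N`. -/
def conductorVal (N : Submodule (unitBall v) M) (x : M) : ℝ≥0∞ :=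
  ⨅ (a : unitBall v) (_ : a • x ∈ N), ballVal v a

/-- The size of the chain `N ≤ N + ⟨x₁⟩ ≤ N + ⟨x₁, x₂⟩ ≤ ⋯`. -/
def chainVal : Submodule (unitBall v) M → List M → ℝ≥0∞
  | _, [] => 0
  | N, x :: l => conductorVal v N x + chainVal (N ⊔ Submodule.span _ {x}) l

/-- The supremum of the sizes of all chains of submodules above `N`. -/
def relLength (N : Submodule (unitBall v) M) : ℝ≥0∞ := ⨆ l, chainVal v N l

variable (M) in
/-- The supremum of the sizes of all chains of finitely generated submodules. -/
def valLength : ℝ≥0∞ := relLength v (⊥ : Submodule (unitBall v) M)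

variable {v}

theorem conductorVal_le {N : Submodule (unitBall v) M} {x : M} {a : unitBall v} (h : a • x ∈ N) :
    conductorVal v N x ≤ ballVal v a := iInf₂_le a h

theorem conductorVal_anti {N N' : Submodule (unitBall v) M} (h : N ≤ N') (x : M) :
    conductorVal v N' x ≤ conductorVal v N x :=
  le_iInf₂ fun _ ha => conductorVal_le (h ha)

theorem conductorVal_of_mem {N : Submodule (unitBall v) M} {x : M} (h : x ∈ N) :
    conductorVal v N x = 0 := by
  refine le_antisymm ?_ bot_le
  rw [← ballVal_one v]
  exact conductorVal_le (by simpa using h)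

theorem chainVal_anti {N N' : Submodule (unitBall v) M} (h : N ≤ N') (l : List M) :
    chainVal v N' l ≤ chainVal v N l := by
  induction l generalizing N N' with
  | nil => exact le_rfl
  | cons x l ih => exact add_le_add (conductorVal_anti h x) (ih (sup_le_sup_right h _))

theorem chainVal_append (N : Submodule (unitBall v) M) (l l' : List M) :
    ∃ N', chainVal v N (l ++ l') = chainVal v N l + chainVal v N' l' ∧
      N' = N ⊔ Submodule.span _ {x | x ∈ l} := by
  induction l generalizing N with
  | nil => exact ⟨N, by simp [chainVal], by simp⟩
  | cons x l ih =>
    obtain ⟨N', h1, h2⟩ := ih (N ⊔ Submodule.span _ {x})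
    refine ⟨N', by simp [chainVal, h1, add_assoc], ?_⟩
    rw [h2, sup_assoc, ← Submodule.span_union]
    congr 2
    ext y
    simp

/-- Conductors do not change under pullback along `p`, and since the preimage of `N` already
contains the kernel, adjoining `x` to it gives the whole preimage of `N + ⟨p x⟩`. -/
theorem chainVal_map_of_surjective (p : M →ₗ[unitBall v] M'') (hp : Function.Surjective p)
    (N : Submodule (unitBall v) M'') (l : List M) :
    chainVal v N (l.map p) = chainVal v (N.comap p) l := by
  induction l generalizing N with
  | nil => rfl
  | cons x l ih =>
    simp only [List.map_cons, chainVal, ih]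
    congr 2
    · simp [conductorVal]
    · have hN : (N.comap p).map p = N := Submodule.map_comap_eq_of_surjective hp N
      nth_rw 1 [← hN]
      rw [← Set.image_singleton, ← Submodule.map_span, ← Submodule.map_sup, Submodule.comap_map_eq,
        sup_eq_left]
      exact le_trans (fun y hy => by simp [LinearMap.mem_ker.1 hy]) le_sup_left

theorem chainVal_map_of_injective (i : M' →ₗ[unitBall v] M) (hi : Function.Injective i)
    (N : Submodule (unitBall v) M') (l : List M') :
    chainVal v (N.map i) (l.map i) = chainVal v N l := by
  induction l generalizing N with
  | nil => rfl
  | cons x l ih =>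
    simp only [List.map_cons, chainVal, ← ih]
    congr 2
    · simp only [conductorVal, ← map_smul]
      simp only [Submodule.mem_map, hi.eq_iff, exists_eq_right]
    · rw [← Set.image_singleton, ← Submodule.map_span, ← Submodule.map_sup]

/-- The inequality `≤` of additivity, in a form that survives induction. If `a • p x` lies in the
image of `N`, then `a • x - n = i m` for some `n ∈ N`, and `b • m ∈ N'` implies `(a * b) • x ∈ N`.
Hence the step at `x` costs at most `v a` plus the cost of adjoining `m` to `N'`; the infimum over
`a` gives the step at `p x`. -/
theorem chainVal_le_of_le_comap (i : M' →ₗ[unitBall v] M) (p : M →ₗ[unitBall v] M'')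
    (hip : Function.Exact i p) (N : Submodule (unitBall v) M) (N' : Submodule (unitBall v) M')
    (hN : N' ≤ N.comap i) (l : List M) :
    chainVal v N l ≤ relLength v N' + chainVal v (N.map p) (l.map p) := by
  induction l generalizing N N' with
  | nil => simp [chainVal]
  | cons x l ih =>
    simp only [List.map_cons, chainVal]
    rw [← add_assoc, add_comm (relLength v N'), add_assoc]
    nth_rw 2 [conductorVal]
    simp only [ENNReal.iInf_add]
    refine le_iInf₂ fun a ha => ?_
    obtain ⟨n, hn, hnx⟩ := ha
    have hex : p (a • x - n) = 0 := by rw [map_sub, map_smul, hnx, sub_self]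
    obtain ⟨m, hm⟩ := (hip _).1 hex
    have hle : N' ⊔ Submodule.span _ {m} ≤ (N ⊔ Submodule.span _ {x}).comap i := by
      refine sup_le (hN.trans (Submodule.comap_mono le_sup_left)) ?_
      rw [Submodule.span_singleton_le_iff_mem, Submodule.mem_comap, hm]
      exact sub_mem ((le_sup_right : _ ≤ N ⊔ _)
        (Submodule.smul_mem _ _ (Submodule.mem_span_singleton_self x))) (le_sup_left (a := N) hn)
    have h1 := ih (N ⊔ Submodule.span _ {x}) _ hle
    have h2 : conductorVal v N x ≤ ballVal v a + conductorVal v N' m := by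
      rw [conductorVal, conductorVal, ENNReal.add_iInf₂ ]
      · refine le_iInf₂ fun b hb => ?_
        rw [← ballVal_mul]
        refine iInf₂_le _ ?_
        have h3 : (a * b) • x = b • (a • x - n) + b • n := by
          rw [smul_sub, sub_add_cancel, smul_smul, mul_comm]
        rw [h3, ← hm, ← map_smul]
        exact add_mem (hN hb) (N.smul_mem _ hn)
    have h3 : conductorVal v N' m + relLength v (N' ⊔ Submodule.span _ {m}) ≤ relLength v N' := by
      rw [relLength, ENNReal.add_iSup]
      exact iSup_le fun l' => le_iSup (fun l => chainVal v N' l) (m :: l')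
    rw [Submodule.map_sup, Submodule.map_span, Set.image_singleton] at h1
    calc _ ≤ (ballVal v a + conductorVal v N' m) + (relLength v (N' ⊔ Submodule.span _ {m})
            + chainVal v (N.map p ⊔ Submodule.span _ {p x}) (l.map p)) := add_le_add h2 h1
      _ = ballVal v a + ((conductorVal v N' m + relLength v (N' ⊔ Submodule.span _ {m}))
            + chainVal v (N.map p ⊔ Submodule.span _ {p x}) (l.map p)) := by ring
      _ ≤ _ := by gcongr

/-- For `≥`, a chain in `M'` is followed by a lift of a chain in `M''`. The first part spans a
submodule of `ker p`, and conductors only shrink when the lower module is replaced by `ker p`. -/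
theorem valLength_eq_add (i : M' →ₗ[unitBall v] M) (p : M →ₗ[unitBall v] M'')
    (hi : Function.Injective i) (hp : Function.Surjective p) (hip : Function.Exact i p) :
    valLength v M = valLength v M' + valLength v M'' := by
  refine le_antisymm (iSup_le fun l => ?_) ?_
  · refine (chainVal_le_of_le_comap i p hip ⊥ ⊥ bot_le l).trans ?_
    rw [Submodule.map_bot]
    exact add_le_add le_rfl (le_iSup (fun l => chainVal v _ l) _)
  · refine ENNReal.iSup_add_iSup_le fun l' l'' => ?_
    obtain ⟨l, rfl⟩ : ∃ l : List M, l.map p = l'' := List.map_surjective_iff.2 hp l''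
    obtain ⟨N, h1, h2⟩ := chainVal_append (v := v) ⊥ (l'.map i) l
    refine le_trans ?_ (le_iSup (fun l => chainVal v _ l) (l'.map i ++ l))
    rw [h1, chainVal_map_of_surjective p hp, ← chainVal_map_of_injective i hi, Submodule.map_bot]
    refine add_le_add le_rfl (chainVal_anti ?_ l)
    rw [h2, bot_sup_eq, Submodule.span_le]
    intro x hx
    obtain ⟨y, -, rfl⟩ := List.mem_map.1 hx
    exact (hip _).2 ⟨y, rfl⟩

theorem valLength_le_of_injective (i : M' →ₗ[unitBall v] M) (hi : Function.Injective i) :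
    valLength v M' ≤ valLength v M := by
  rw [valLength_eq_add i (LinearMap.range i).mkQ hi (Submodule.mkQ_surjective _)
    (LinearMap.exact_map_mkQ_range i)]
  exact le_self_add

theorem valLength_le_of_surjective (p : M →ₗ[unitBall v] M'') (hp : Function.Surjective p) :
    valLength v M'' ≤ valLength v M := by
  rw [valLength_eq_add (LinearMap.ker p).subtype p (Submodule.subtype_injective _) hp
    (LinearMap.exact_subtype_ker_map p)]
  exact le_add_self

theorem valLength_congr (e : M ≃ₗ[unitBall v] M') : valLength v M = valLength v M' :=
  (valLength_le_of_injective e.toLinearMap e.injective).antisymm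
    (valLength_le_of_surjective e.toLinearMap e.surjective)

theorem valLength_quotient (N : Submodule (unitBall v) M) :
    valLength v (M ⧸ N) = relLength v N := by
  refine le_antisymm (iSup_le fun l => ?_) (iSup_le fun l => ?_)
  · obtain ⟨l, rfl⟩ : ∃ l' : List M, l'.map N.mkQ = l :=
      List.map_surjective_iff.2 (Submodule.mkQ_surjective N) l
    rw [chainVal_map_of_surjective _ (Submodule.mkQ_surjective N)]
    refine le_trans (le_of_eq ?_) (le_iSup (fun l => chainVal v N l) l)
    congr
    exact Submodule.ker_mkQ N
  · refine le_trans (le_of_eq ?_) (le_iSup (fun l => chainVal v _ l) (l.map N.mkQ))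
    rw [chainVal_map_of_surjective _ (Submodule.mkQ_surjective N)]
    congr
    exact (Submodule.ker_mkQ N).symm

/-- Cyclic submodules are totally ordered, so a chain starting at `⟨g⟩` stays cyclic. Either `x` is
a multiple of the current generator and costs nothing, or `g = a • x`; the step then costs at most
`v a` and leaves the budget `C - v a` for `x`. -/
theorem chainVal_span_singleton_le (hM : ∀ x y : M, (∃ a : unitBall v, x = a • y) ∨
    ∃ a : unitBall v, y = a • x) (g : M) (C : ℝ≥0∞)
    (hC : ∀ (y : M) (a : unitBall v), g = a • y → ballVal v a ≤ C) (l : List M) :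
    chainVal v (Submodule.span _ {g}) l ≤ C := by
  induction l generalizing g C with
  | nil => exact bot_le
  | cons x l ih =>
    rw [chainVal]
    rcases hM x g with ⟨a, rfl⟩ | ⟨a, rfl⟩
    · have hx : a • g ∈ Submodule.span (unitBall v) {g} :=
        Submodule.smul_mem _ _ (Submodule.mem_span_singleton_self g)
      rw [conductorVal_of_mem hx, zero_add, sup_eq_left.2]
      · exact ih g C hC
      · rwa [Submodule.span_singleton_le_iff_mem]
    · rw [sup_eq_right.2]
      · by_cases htop : ballVal v a = ⊤
        · exact le_top.trans (htop ▸ hC x a rfl)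
        have h1 : conductorVal v (Submodule.span _ {a • x}) x ≤ ballVal v a :=
          conductorVal_le (Submodule.mem_span_singleton_self _)
        have h2 := ih x (C - ballVal v a) fun y b hb =>
          ENNReal.le_sub_of_add_le_left htop <| by
            rw [← ballVal_mul]
            exact hC y (a * b) (by rw [hb, smul_smul])
        calc _ ≤ ballVal v a + (C - ballVal v a) := add_le_add h1 h2
          _ = C := add_tsub_cancel_of_le (hC x a rfl)
      · rw [Submodule.span_singleton_le_iff_mem]
        exact Submodule.smul_mem _ _ (Submodule.mem_span_singleton_self x)

theorem conductorVal_le_relLength (N : Submodule (unitBall v) M) (x : M) :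
    conductorVal v N x ≤ relLength v N := by
  refine le_trans (le_of_eq ?_) (le_iSup (fun l => chainVal v N l) [x])
  simp [chainVal]

/-- In a torsion free module in which the cyclic submodules form a chain, the length of the
quotient by a cyclic submodule. -/
theorem relLength_span_singleton (hM : ∀ x y : M, (∃ a : unitBall v, x = a • y) ∨
    ∃ a : unitBall v, y = a • x) (htf : ∀ (a : unitBall v) (x : M), a • x = 0 → a = 0 ∨ x = 0)
    {g : M} (hg : g ≠ 0) :
    relLength v (Submodule.span _ {g}) =
      ⨆ (y : M) (a : unitBall v) (_ : g = a • y), ballVal v a := by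
  refine le_antisymm (iSup_le fun l => chainVal_span_singleton_le hM g _
    (fun y a h => le_iSup₂_of_le y a (le_iSup_of_le h le_rfl)) l)
    (iSup₂_le fun y a => iSup_le fun h => ?_)
  -- If `b • y = c • g = (c * a) • y`, torsion-freeness gives `b = c * a`, so adjoining `y` costs at
  -- least `v a`.
  refine le_trans (le_iInf₂ fun b hb => ?_) (conductorVal_le_relLength _ y)
  obtain ⟨c, hc⟩ := Submodule.mem_span_singleton.1 hb
  have hy : y ≠ 0 := fun h0 => hg (by rw [h, h0, smul_zero])
  have h1 : (b - c * a) • y = 0 := by rw [sub_smul, ← hc, h, smul_smul, sub_self]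
  rw [sub_eq_zero.1 ((htf _ _ h1).resolve_right hy), ballVal_mul]
  exact le_add_self

/-- A module with a vector with zero annihilator has infinite length. -/
theorem valLength_eq_top {x : M} (hx : ∀ a : unitBall v, a • x = 0 → a = 0) :
    valLength v M = ⊤ := by
  refine top_le_iff.1 (le_trans (le_iInf₂ fun b hb => ?_) (conductorVal_le_relLength _ x))
  rw [hx b (by simpa using hb), ballVal_zero]

theorem valLength_quotient_span_singleton (α : unitBall v) :
    valLength v (unitBall v ⧸ Ideal.span {α}) = ballVal v α := by
  by_cases hα : α = 0
  · rw [hα, ballVal_zero]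
    refine valLength_eq_top (x := Ideal.Quotient.mk _ 1) fun a ha => ?_
    have h1 : (Ideal.Quotient.mk (Ideal.span {(0 : unitBall v)})) (a * 1) = 0 := ha
    simpa [Ideal.Quotient.eq_zero_iff_mem] using h1
  · rw [valLength_quotient]
    refine (relLength_span_singleton (M := unitBall v) ?_ ?_ hα).trans ?_
    · intro x y
      rcases ValuationRing.dvd_total x y with ⟨c, hc⟩ | ⟨c, hc⟩
      · exact .inr ⟨c, by rw [hc, smul_eq_mul, mul_comm]⟩
      · exact .inl ⟨c, by rw [hc, smul_eq_mul, mul_comm]⟩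
    · intro a x h
      simpa using h
    · refine le_antisymm (iSup₂_le fun y a => iSup_le fun h => ?_)
        (le_iSup₂_of_le 1 α (le_iSup_of_le (by simp) le_rfl))
      rw [h, smul_eq_mul, ballVal_mul]
      exact le_self_add

theorem valLength_pi (n : ℕ) (α : Fin n → unitBall v) :
    valLength v ((i : Fin n) → unitBall v ⧸ Ideal.span {α i}) = ∑ i, ballVal v (α i) := by
  induction n with
  | zero =>
    refine le_antisymm (iSup_le fun l => ?_) (by simp)
    induction l with
    | nil => exact bot_le
    | cons x l ih =>
      rw [Subsingleton.elim x 0, chainVal, conductorVal_of_mem (zero_mem _)]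
      simpa using ih
  | succ n ih =>
    let p : ((i : Fin (n + 1)) → unitBall v ⧸ Ideal.span {α i}) →ₗ[unitBall v]
        ((i : Fin n) → unitBall v ⧸ Ideal.span {α i.succ}) :=
      LinearMap.pi fun i => LinearMap.proj i.succ
    let j : (unitBall v ⧸ Ideal.span {α 0}) →ₗ[unitBall v]
        ((i : Fin (n + 1)) → unitBall v ⧸ Ideal.span {α i}) :=
      LinearMap.single (unitBall v) (fun i : Fin (n + 1) => unitBall v ⧸ Ideal.span {α i}) 0
    rw [valLength_eq_add j p, ih (fun i => α i.succ), valLength_quotient_span_singleton,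
      Fin.sum_univ_succ]
    · exact Pi.single_injective (M := fun i : Fin (n + 1) => unitBall v ⧸ Ideal.span {α i}) 0
    · intro y
      exact ⟨Fin.cons 0 y, funext fun i => rfl⟩
    · intro x
      constructor
      · intro hx
        refine ⟨x 0, funext fun i => ?_⟩
        refine Fin.cases ?_ (fun i => ?_) i
        · simp [j]
        · simpa [j, p] using (congrFun hx i).symm
      · rintro ⟨y, rfl⟩
        exact funext fun i => by simp [j, p]

end Length

/-! ### Smith normal form, and comparison of the content with the weighted length. -/

section Content

variable {F : Type*} [Field F] {v : AddValuation F (WithTop ℝ)}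

/-- A finite nonempty set of coordinates contains one dividing all others. -/
theorem exists_pivot {n : ℕ} (N : Submodule (unitBall v) (Fin (n + 1) → unitBall v)) (hN : N.FG) :
    ∃ g ∈ N, ∃ j, ∀ x ∈ N, ∀ k, g j ∣ x k := by
  classical
  obtain ⟨S, rfl⟩ := hN
  obtain ⟨⟨g, j⟩, hg, hmin⟩ := Finset.exists_min_image
    (insert 0 S ×ˢ (Finset.univ : Finset (Fin (n + 1)))) (fun p => ballVal v (p.1 p.2)) ⟨(0, 0), by simp⟩
  refine ⟨g, ?_, j, fun x hx => ?_⟩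
  · rcases Finset.mem_insert.1 (Finset.mem_product.1 hg).1 with h | h
    · rw [show g = 0 from h]; exact zero_mem _
    · exact Submodule.subset_span h
  · refine Submodule.span_induction (fun y hy k => ?_) (fun k => dvd_zero _)
      (fun y z _ _ hy hz k => dvd_add (hy k) (hz k)) (fun a y _ hy k => (hy k).mul_left a) hx
    exact (dvd_iff_ballVal_le v).2 (hmin (y, k) (by simp [Finset.mem_coe.1 hy]))

/-- Smith normal form of a finitely generated submodule of a free module over a valuation ring. -/
theorem exists_smith_form {n : ℕ} (N : Submodule (unitBall v) (Fin n → unitBall v)) (hN : N.FG) :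
    ∃ (e : (Fin n → unitBall v) ≃ₗ[unitBall v] (Fin n → unitBall v)) (α : Fin n → unitBall v),
      ∀ x, x ∈ N ↔ ∀ i, α i ∣ e x i := by
  induction n with
  | zero =>
    refine ⟨LinearEquiv.refl _ _, 0, fun x => ?_⟩
    rw [Subsingleton.elim x 0]
    exact ⟨fun _ i => i.elim0, fun _ => zero_mem _⟩
  | succ n ih =>
    obtain ⟨g, hg, j, hj⟩ := exists_pivot N hN
    -- The pivot vector divided by its pivot entry. If that entry is `0`, then `N = 0` and any `u`
    -- with `u j = 1` serves.
    obtain ⟨u, hu, huj⟩ : ∃ u : Fin (n + 1) → unitBall v, g = g j • u ∧ u j = 1 := by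
      by_cases h0 : g j = 0
      · refine ⟨Pi.single j 1, funext fun k => ?_, by simp⟩
        simpa [h0] using hj g hg k
      · choose u hu using hj g hg
        exact ⟨u, funext hu, by simpa [h0] using hu j⟩
    -- Projection along `u` onto the coordinates other than `j`; it kills `g`.
    let ψ : (Fin (n + 1) → unitBall v) →ₗ[unitBall v] (Fin n → unitBall v) :=
      LinearMap.pi fun k => LinearMap.proj (j.succAbove k) - u (j.succAbove k) • LinearMap.proj j
    have hψ : ∀ x k, ψ x k = x (j.succAbove k) - u (j.succAbove k) * x j := fun _ _ => rfl
    obtain ⟨e, α, he⟩ := ih (N.map ψ) (hN.map ψ)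
    let E : (Fin (n + 1) → unitBall v) ≃ₗ[unitBall v] (Fin (n + 1) → unitBall v) :=
      { toFun := fun x => Fin.cons (x j) (e (ψ x))
        map_add' := fun x y => by
          funext k
          refine Fin.cases ?_ (fun k => ?_) k <;> simp
        map_smul' := fun a y => by
          funext k
          refine Fin.cases ?_ (fun k => ?_) k <;> simp
        invFun := fun z => j.insertNth (z 0)
          fun k => e.symm (Fin.tail z) k + u (j.succAbove k) * z 0
        left_inv := fun x => by
          funext k
          refine j.succAboveCases ?_ (fun k => ?_) k
          · simp
          · simp [hψ]
        right_inv := fun z => by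
          funext k
          refine Fin.cases ?_ (fun k => ?_) k
          · simp
          · have : ψ (j.insertNth (z 0) fun k => e.symm (Fin.tail z) k + u (j.succAbove k) * z 0) =
                e.symm (Fin.tail z) := funext fun i => by simp [hψ]
            simp [this, Fin.tail] }
    refine ⟨E, Fin.cons (g j) α, fun x => ?_⟩
    have hE : (∀ i, (Fin.cons (g j) α : Fin (n + 1) → unitBall v) i ∣ E x i) ↔
        g j ∣ x j ∧ ψ x ∈ N.map ψ := by
      rw [he, Fin.forall_fin_succ]
      rfl
    rw [hE]
    refine ⟨fun hx => ⟨hj x hx j, Submodule.mem_map_of_mem hx⟩, ?_⟩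
    rintro ⟨⟨c, hc⟩, y, hy, hyx⟩
    obtain ⟨d, hd⟩ := hj y hy j
    -- Since `ψ x = ψ y`, the difference is a multiple of `u`; its `j`-th coordinate `g j * (c - d)`
    -- makes it a multiple of `g`.
    have hxy : x = y + (c - d) • g := by
      funext k
      refine j.succAboveCases ?_ (fun k => ?_) k
      · simp [hc, hd]; ring
      · have h1 := congrFun hyx k
        rw [hψ, hψ, hc, hd] at h1
        have h2 : g (j.succAbove k) = g j * u (j.succAbove k) := congrFun hu _
        simp only [Pi.add_apply, Pi.smul_apply, smul_eq_mul, h2]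
        linear_combination -h1
    rw [hxy]
    exact add_mem hy (N.smul_mem _ hg)

/-- The quotient by a submodule in Smith normal form. -/
theorem nonempty_quotient_equiv {n : ℕ} {N : Submodule (unitBall v) (Fin n → unitBall v)}
    (e : (Fin n → unitBall v) ≃ₗ[unitBall v] (Fin n → unitBall v)) (α : Fin n → unitBall v)
    (h : ∀ x, x ∈ N ↔ ∀ i, α i ∣ e x i) :
    Nonempty (((Fin n → unitBall v) ⧸ N) ≃ₗ[unitBall v]
      ((i : Fin n) → unitBall v ⧸ Ideal.span {α i})) := by
  let f : (Fin n → unitBall v) →ₗ[unitBall v] ((i : Fin n) → unitBall v ⧸ Ideal.span {α i}) :=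
    (LinearMap.pi fun i => (Submodule.mkQ (Ideal.span {α i})).comp (LinearMap.proj i)).comp
      e.toLinearMap
  have hf : Function.Surjective f := by
    intro y
    choose z hz using fun i => Submodule.mkQ_surjective _ (y i)
    exact ⟨e.symm z, funext fun i => by simp [f, ← hz]⟩
  have hker : N = LinearMap.ker f := by
    ext x
    rw [h, LinearMap.mem_ker, funext_iff]
    refine forall_congr' fun i => ?_
    rw [← Ideal.mem_span_singleton]
    exact (Submodule.Quotient.mk_eq_zero _).symm
  exact ⟨(Submodule.quotEquivOfEq _ _ hker).trans (f.quotKerEquivOfSurjective hf)⟩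

theorem coe_sum_ballVal {n : ℕ} (α : Fin n → unitBall v) :
    ((∑ i, ballVal v (α i) : ℝ≥0∞) : EReal) = ∑ i, toEReal (v (α i : F)) := by
  induction n with
  | zero => simp
  | succ n ih => rw [Fin.sum_univ_succ, Fin.sum_univ_succ, EReal.coe_ennreal_add, coe_ballVal, ih]

variable (v) in
-- Additivity evaluates every cyclic decomposition to the same number, and Smith normal form
-- supplies one.
theorem contentFP_eq_valLength (M : Type*) [AddCommGroup M] [Module (unitBall v) M]
    [Module.FinitePresentation (unitBall v) M] :
    contentFP v M = (valLength v M : EReal) := by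
  have key : ∀ (n : ℕ) (α : Fin n → unitBall v),
      Nonempty (M ≃ₗ[unitBall v] ((i : Fin n) → unitBall v ⧸ Ideal.span {α i})) →
      ∑ i, toEReal (v (α i : F)) = (valLength v M : EReal) := by
    rintro n α ⟨e⟩
    rw [valLength_congr e, valLength_pi, coe_sum_ballVal]
  refine le_antisymm (iSup₂_le fun n α => iSup_le fun h => (key n α h).le) ?_
  obtain ⟨n, N, e, hN⟩ := Module.FinitePresentation.exists_fin (unitBall v) M
  obtain ⟨e', α, h⟩ := exists_smith_form N hN
  obtain ⟨f⟩ := nonempty_quotient_equiv e' α h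
  rw [← key n α ⟨e.trans f⟩]
  exact le_iSup₂_of_le n α (le_iSup_of_le ⟨e.trans f⟩ le_rfl)

variable (v) in
/-- An element of small valuation multiplying every ideal into a principal subideal. -/
theorem exists_almost_principal {ε : ℝ≥0∞} (hε : ε ≠ 0) :
    ∃ π : unitBall v, π ≠ 0 ∧ ballVal v π ≤ ε ∧
      ∀ I : Ideal (unitBall v), ∃ β ∈ I, ∀ a ∈ I, β ∣ π * a := by
  have key : ∀ δ : ℝ≥0∞, δ ≠ 0 → ∀ I : Ideal (unitBall v), ∃ β ∈ I, ∀ a ∈ I, a ≠ 0 →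
      ballVal v β < ballVal v a + δ := by
    intro δ hδ I
    by_cases htop : ⨅ a ∈ I, ballVal v a = ⊤
    · refine ⟨0, zero_mem _, fun a ha ha0 => (ha0 ?_).elim⟩
      rw [← ballVal_eq_top v, ← top_le_iff, ← htop]
      exact iInf₂_le a ha
    · have h1 := ENNReal.lt_add_right htop hδ
      rw [show (⨅ a ∈ I, ballVal v a) = ⨅ a : I, ballVal v a from iInf_subtype', iInf_lt_iff] at h1
      obtain ⟨β, hβ⟩ := h1
      refine ⟨β, β.2, fun a ha _ => hβ.trans_le ?_⟩
      gcongr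
      exact iInf_le (fun a : I => ballVal v a) ⟨a, ha⟩
  -- If some value lies in `(0, ε]`, an element of `I` within that distance of the infimum works.
  -- Otherwise no value lies there, so an element within `ε` of the infimum generates `I` and `π =
  -- 1` suffices.
  by_cases hd : ∃ π : unitBall v, π ≠ 0 ∧ ballVal v π ≤ ε ∧ ballVal v π ≠ 0
  · obtain ⟨π, h0, h1, h2⟩ := hd
    refine ⟨π, h0, h1, fun I => ?_⟩
    obtain ⟨β, hβ, h⟩ := key _ h2 I
    refine ⟨β, hβ, fun a ha => ?_⟩
    by_cases ha0 : a = 0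
    · simp [ha0]
    rw [dvd_iff_ballVal_le, ballVal_mul, add_comm]
    exact (h a ha ha0).le
  · push Not at hd
    refine ⟨1, one_ne_zero, by simp, fun I => ?_⟩
    obtain ⟨β, hβ, h⟩ := key _ hε I
    refine ⟨β, hβ, fun a ha => ?_⟩
    rw [one_mul]
    by_cases ha0 : a = 0
    · simp [ha0]
    rcases ValuationRing.dvd_total β a with h1 | ⟨c, rfl⟩
    · exact h1
    have h2 := h a ha ha0
    have hc : ballVal v c < ε := by
      rw [ballVal_mul] at h2
      exact lt_of_add_lt_add_left h2
    have hc0 : c ≠ 0 := by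
      rintro rfl
      simp at hc
    rw [dvd_iff_ballVal_le, ballVal_mul, hd c hc0 hc.le, add_zero]

/-- Submodules of free modules are almost finitely generated. -/
theorem exists_fg_le {π : unitBall v}
    (hπ : ∀ I : Ideal (unitBall v), ∃ β ∈ I, ∀ a ∈ I, β ∣ π * a) {n : ℕ}
    (P : Submodule (unitBall v) (Fin n → unitBall v)) :
    ∃ P' ≤ P, P'.FG ∧ ∀ x ∈ P, π ^ n • x ∈ P' := by
  induction n with
  | zero =>
    refine ⟨⊥, bot_le, Submodule.fg_bot, fun x _ => ?_⟩
    rw [Subsingleton.elim (π ^ 0 • x) 0]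
    exact zero_mem _
  | succ n ih =>
    let ι : (Fin n → unitBall v) →ₗ[unitBall v] (Fin (n + 1) → unitBall v) :=
      { toFun := fun y => Fin.cons 0 y
        map_add' := fun x y => by
          funext k
          refine Fin.cases ?_ (fun k => ?_) k <;> simp
        map_smul' := fun a y => by
          funext k
          refine Fin.cases ?_ (fun k => ?_) k <;> simp }
    obtain ⟨Q, hQP, hQ, hQπ⟩ := ih (P.comap ι)
    -- The vector `p` lifts an almost generator of the ideal of first coordinates. Subtracting a
    -- multiple of `p` from `π • x` kills the first coordinate, and the induction hypothesis costs a
    -- further `π ^ n`.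
    obtain ⟨β, ⟨p, hp, hpβ⟩, hβ⟩ := hπ (P.map (LinearMap.proj 0))
    refine ⟨Submodule.span _ {p} ⊔ Q.map ι, sup_le ?_ (Submodule.map_le_iff_le_comap.2 hQP),
      (Submodule.fg_span_singleton p).sup (hQ.map ι), fun x hx => ?_⟩
    · rwa [Submodule.span_singleton_le_iff_mem]
    · obtain ⟨c, hc⟩ := hβ (x 0) ⟨x, hx, rfl⟩
      have h1 : ι (Fin.tail (π • x - c • p)) = π • x - c • p := by
        funext k
        refine Fin.cases ?_ (fun k => rfl) k
        have h2 : p 0 = β := hpβ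
        simp [ι, h2, hc, mul_comm]
      have h3 : Fin.tail (π • x - c • p) ∈ P.comap ι := by
        rw [Submodule.mem_comap, h1]
        exact sub_mem (P.smul_mem _ hx) (P.smul_mem _ hp)
      have h4 : π ^ (n + 1) • x = (π ^ n * c) • p + ι (π ^ n • Fin.tail (π • x - c • p)) := by
        rw [map_smul, h1, smul_sub, smul_smul, smul_smul, ← pow_succ]
        abel
      rw [h4]
      exact Submodule.add_mem_sup (Submodule.smul_mem _ _ (Submodule.mem_span_singleton_self p))
        (Submodule.mem_map_of_mem (hQπ _ h3))

@[simp] theorem ballVal_pow (a : unitBall v) (n : ℕ) : ballVal v (a ^ n) = n * ballVal v a := by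
  induction n with
  | zero => simp
  | succ n ih => rw [pow_succ, ballVal_mul, ih]; push_cast; ring

/-- Finitely generated modules have finitely presented quotients of almost the same length. -/
theorem exists_finitePresentation_quotient (N : Type*) [AddCommGroup N] [Module (unitBall v) N]
    [Module.Finite (unitBall v) N] {ε : ℝ≥0∞} (hε : ε ≠ 0) :
    ∃ P : Submodule (unitBall v) N, Module.FinitePresentation (unitBall v) (N ⧸ P) ∧
      valLength v N ≤ valLength v (N ⧸ P) + ε := by
  obtain ⟨n, p, hp⟩ := Module.Finite.exists_fin' (unitBall v) N
  -- Each of the `n` coordinates will lose at most `n * v π`, whence the denominator `n * n`.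
  obtain ⟨π, hπ0, hπε, hπ⟩ := exists_almost_principal v (ε := ε / (n * n : ℕ))
    (ENNReal.div_ne_zero.2 ⟨hε, ENNReal.natCast_ne_top _⟩)
  obtain ⟨P', hP', hfg, hπP⟩ := exists_fg_le hπ (LinearMap.ker p)
  obtain ⟨e, α, he⟩ := exists_smith_form P' hfg
  -- Take `δ i = α i / π ^ n`, or `1` if `α i` divides `π ^ n`. The submodule `D` cut out by the `δ
  -- i` then contains `ker p`.
  have hδ : ∀ i, ∃ δ : unitBall v, (∀ y, α i ∣ π ^ n * y → δ ∣ y) ∧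
      ballVal v (α i) ≤ ballVal v δ + n * ballVal v π := by
    intro i
    rcases ValuationRing.dvd_total (α i) (π ^ n) with h | ⟨δ, h⟩
    · refine ⟨1, fun y _ => one_dvd y, ?_⟩
      rw [ballVal_one, zero_add, ← ballVal_pow]
      exact (dvd_iff_ballVal_le v).1 h
    · refine ⟨δ, fun y hy => ?_, ?_⟩
      · rw [h] at hy
        exact (mul_dvd_mul_iff_left (pow_ne_zero n hπ0)).1 hy
      · rw [h, ballVal_mul, ballVal_pow, add_comm]
  choose δ hδ1 hδ2 using hδ
  let D : Submodule (unitBall v) (Fin n → unitBall v) :=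
    { carrier := {x | ∀ i, δ i ∣ e x i}
      add_mem' := fun hx hy i => by
        rw [map_add]
        exact dvd_add (hx i) (hy i)
      zero_mem' := fun i => by simp
      smul_mem' := fun a x hx i => by
        rw [map_smul]
        exact (hx i).mul_left a }
  have hPD : LinearMap.ker p ≤ D := fun x hx i => hδ1 i _ <| by
    have h := (he _).1 (hπP x hx) i
    rwa [map_smul] at h
  obtain ⟨f⟩ := nonempty_quotient_equiv (N := D) e δ fun x => Iff.rfl
  have hker : D = LinearMap.ker ((D.map p).mkQ.comp p) := by
    rw [LinearMap.ker_comp, Submodule.ker_mkQ, Submodule.comap_map_eq, sup_eq_left.2 hPD]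
  let q : (N ⧸ D.map p) ≃ₗ[unitBall v] ((i : Fin n) → unitBall v ⧸ Ideal.span {δ i}) :=
    (((Submodule.quotEquivOfEq _ _ hker).trans (LinearMap.quotKerEquivOfSurjective _
      ((Submodule.mkQ_surjective _).comp hp))).symm).trans f
  refine ⟨D.map p, ?_, ?_⟩
  · have h1 : ∀ i, Module.FinitePresentation (unitBall v) (unitBall v ⧸ Ideal.span {δ i}) :=
      fun i => Module.finitePresentation_of_surjective (Submodule.mkQ _)
        (Submodule.mkQ_surjective _) (by
          rw [Submodule.ker_mkQ]
          exact Submodule.fg_span_singleton _)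
    exact Module.FinitePresentation.of_equiv q.symm
  · obtain ⟨f'⟩ := nonempty_quotient_equiv e α he
    have hsurj : Function.Surjective (P'.liftQ p hP') := fun y => by
      obtain ⟨x, rfl⟩ := hp y
      exact ⟨P'.mkQ x, rfl⟩
    have h1 := valLength_le_of_surjective (P'.liftQ p hP') hsurj
    rw [valLength_congr f', valLength_pi] at h1
    rw [valLength_congr q, valLength_pi]
    refine (h1.trans (Finset.sum_le_sum fun i _ => hδ2 i)).trans ?_
    rw [Finset.sum_add_distrib, Finset.sum_const, Finset.card_univ, Fintype.card_fin, nsmul_eq_mul,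
      ← mul_assoc, ← Nat.cast_mul]
    gcongr
    exact (mul_le_mul_right hπε _).trans ENNReal.mul_div_le

variable (v) in
-- Length is monotone under subquotients. Conversely, a finite chain lives in the finitely generated
-- submodule it spans, which has a finitely presented quotient losing at most `ε` of the length.
theorem content_eq_valLength (M : Type*) [AddCommGroup M] [Module (unitBall v) M] :
    content v M = (valLength v M : EReal) := by
  rw [content]
  split_ifs with hfp
  · exact contentFP_eq_valLength v M
  refine le_antisymm (iSup₂_le fun N P => iSup_le fun h => ?_) ?_
  · rw [contentFP_eq_valLength, EReal.coe_ennreal_le_coe_ennreal_iff]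
    exact (valLength_le_of_surjective P.mkQ (Submodule.mkQ_surjective P)).trans
      (valLength_le_of_injective N.subtype N.injective_subtype)
  · set B := ⨆ (N : Submodule (unitBall v) M) (P : Submodule (unitBall v) N)
      (_ : Module.FinitePresentation (unitBall v) (N ⧸ P)), contentFP v (N ⧸ P)
    have hle : ∀ (N : Submodule (unitBall v) M) (P : Submodule (unitBall v) N),
        Module.FinitePresentation (unitBall v) (N ⧸ P) → (valLength v (N ⧸ P) : EReal) ≤ B := by
      intro N P h
      rw [← contentFP_eq_valLength]
      exact le_iSup₂_of_le N P (le_iSup_of_le h le_rfl)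
    have hB0 : 0 ≤ B := (EReal.coe_ennreal_nonneg _).trans
      (hle ⊥ ⊤ inferInstance)
    rw [← EReal.coe_toENNReal hB0, EReal.coe_ennreal_le_coe_ennreal_iff]
    refine iSup_le fun l => ENNReal.le_of_forall_pos_le_add fun ε hε _ => ?_
    set N := Submodule.span (unitBall v) {x | x ∈ l}
    have hfin : Module.Finite (unitBall v) N :=
      Module.Finite.iff_fg.2 (Submodule.fg_span (List.finite_toSet l))
    obtain ⟨P, hP, hNP⟩ := exists_finitePresentation_quotient N (v := v)
      (ENNReal.coe_ne_zero.2 hε.ne')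
    have hl : (l.attachWith (· ∈ N) fun x hx => Submodule.subset_span hx).map N.subtype = l :=
      List.attachWith_map_subtype_val _
    calc chainVal v ⊥ l ≤ valLength v N := by
          rw [← hl, ← Submodule.map_bot N.subtype,
            chainVal_map_of_injective _ N.injective_subtype]
          exact le_iSup (fun l => chainVal v _ l) _
      _ ≤ valLength v (N ⧸ P) + ε := hNP
      _ ≤ B.toENNReal + ε := by
          gcongr
          rw [← EReal.coe_ennreal_le_coe_ennreal_iff, EReal.coe_toENNReal hB0]
          exact hle N P hP

end Content

/-! ### Separable extensions of transcendence degree one have at most one-dimensional differentials.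
-/

section Separable

open scoped TensorProduct IntermediateField

variable {k E : Type*} [Field k] [Field E] [Algebra k E]

/-- In a geometrically reduced extension, raising to the `p`-th power preserves linear
independence. -/
theorem linearIndepOn_pow_of_isGeometricallyReduced [Algebra.IsGeometricallyReduced k E] {p : ℕ}
    (hp : p.Prime) [CharP k p] (s : Finset E) (hs : LinearIndepOn k id (s : Set E)) :
    LinearIndepOn k (· ^ p) (s : Set E) := by
  have hred : IsReduced (AlgebraicClosure k ⊗[k] E) := inferInstance
  have : Fact p.Prime := ⟨hp⟩
  have hA : CharP (AlgebraicClosure k) p := charP_of_injective_algebraMap' k p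
  have : Nontrivial (AlgebraicClosure k ⊗[k] E) :=
    (Algebra.TensorProduct.includeLeft_injective (R := k) (S := k) (A := AlgebraicClosure k) (B := E)
      (algebraMap k E).injective).nontrivial
  have hT : CharP (AlgebraicClosure k ⊗[k] E) p :=
    charP_of_injective_algebraMap' k p
  rw [linearIndepOn_finset_iff] at hs ⊢
  intro c hc
  have hroot : ∀ x : E, ∃ d : AlgebraicClosure k, d ^ p = algebraMap k _ (c x) := fun x =>
    IsAlgClosed.exists_pow_nat_eq _ hp.pos
  choose d hd using hroot
  -- With `d x` a `p`-th root of `c x`, Frobenius turns this sum into `1 ⊗ ∑ c x • x ^ p = 0`;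
  -- reducedness then makes the sum itself vanish.
  have h1 : (∑ x ∈ s, d x ⊗ₜ[k] x) ^ p = 0 := by
    rw [sum_pow_char]
    simp only [Algebra.TensorProduct.tmul_pow, hd, Algebra.algebraMap_eq_smul_one,
      TensorProduct.smul_tmul]
    rw [← TensorProduct.tmul_sum, hc, TensorProduct.tmul_zero]
  have h2 : ∑ x ∈ s, d x ⊗ₜ[k] x = 0 := eq_zero_of_pow_eq_zero h1
  have hli : LinearIndependent (AlgebraicClosure k)
      (fun x : s => (1 : AlgebraicClosure k) ⊗ₜ[k] (x : E)) :=
    Module.Flat.linearIndependent_one_tmul (linearIndepOn_finset_iff.2 hs)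
  have h3 : ∀ x ∈ s, d x = 0 := by
    rw [Fintype.linearIndependent_iff] at hli
    intro x hx
    refine hli (fun x => d x) ?_ ⟨x, hx⟩
    rw [← h2, ← Finset.sum_coe_sort s]
    exact Finset.sum_congr rfl fun x _ => by simp [TensorProduct.smul_tmul']
  intro x hx
  have h4 := hd x
  rw [h3 x hx, zero_pow hp.ne_zero] at h4
  exact (algebraMap k (AlgebraicClosure k)).injective (by rw [← h4, map_zero])

/-- Finitely generated geometrically reduced extensions are separably generated. -/
theorem exists_separating_transcendence_basis [Algebra.IsGeometricallyReduced k E]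
    [Algebra.EssFiniteType k E] :
    ∃ s : Finset E, IsTranscendenceBasis k ((↑) : s → E) ∧
      Algebra.IsSeparable (IntermediateField.adjoin k (s : Set E)) E := by
  obtain ⟨p, hp⟩ := CharP.exists k
  rcases CharP.char_is_prime_or_zero k p with h | rfl
  · have : ExpChar k p := ExpChar.prime h
    exact exists_isTranscendenceBasis_and_isSeparable_of_linearIndepOn_pow_of_essFiniteType p h
      (linearIndepOn_pow_of_isGeometricallyReduced h)
  · have : CharZero k := CharP.charP_to_charZero k
    exact exists_isTranscendenceBasis_and_isSeparable_of_perfectField k E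

/-- A derivation vanishing on `s` vanishes on every separable extension of `k(s)`. -/
theorem derivation_eq_zero_of_isSeparable {V : Type*} [AddCommGroup V] [Module k V] [Module E V]
    [IsScalarTower k E V]
    (δ : Derivation k E V) (s : Set E) (hs : ∀ x ∈ s, δ x = 0)
    [Algebra.IsSeparable (IntermediateField.adjoin k s) E] (x : E) : δ x = 0 := by
  let F₀ : IntermediateField k E :=
    { carrier := {x | δ x = 0}
      mul_mem' := fun {a b} ha hb => by
        change δ (a * b) = 0
        rw [δ.leibniz, ha, hb, smul_zero, smul_zero, add_zero]
      one_mem' := δ.map_one_eq_zero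
      add_mem' := fun {a b} ha hb => by
        change δ (a + b) = 0
        rw [map_add, ha, hb, add_zero]
      zero_mem' := map_zero δ
      algebraMap_mem' := δ.map_algebraMap
      inv_mem' := fun a ha => by
        change δ a⁻¹ = 0
        rw [Derivation.leibniz_inv, show δ a = 0 from ha, smul_zero] }
  have hle : IntermediateField.adjoin k s ≤ F₀ := IntermediateField.adjoin_le_iff.2 hs
  have hx : IsSeparable (IntermediateField.adjoin k s) x := Algebra.IsSeparable.isSeparable _ x
  set f := minpoly (IntermediateField.adjoin k s) x
  -- As `δ` kills the coefficients, applying it to the minimal polynomial relation gives `f'(x) • δ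
  -- x = 0`, with `f'(x) ≠ 0` by separability.
  have h0 : ∀ q : Polynomial (IntermediateField.adjoin k s),
      δ (Polynomial.aeval x q) = (Polynomial.aeval x q.derivative) • δ x := by
    intro q
    induction q using Polynomial.induction_on' with
    | add p q hp hq => rw [map_add, map_add, hp, hq, Polynomial.derivative_add, map_add, add_smul]
    | monomial n a =>
      have ha : δ (a : E) = 0 := hle a.2
      rw [Polynomial.aeval_monomial, Polynomial.derivative_monomial, Polynomial.aeval_monomial,
        δ.leibniz, δ.leibniz_pow, IntermediateField.algebraMap_apply, ha, smul_zero, add_zero,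
        ← Nat.cast_smul_eq_nsmul E, smul_smul, smul_smul, map_mul, map_natCast,
        IntermediateField.algebraMap_apply, mul_assoc]
  have h1 := h0 f
  rw [minpoly.aeval, map_zero] at h1
  exact (smul_eq_zero.1 h1.symm).resolve_left (hx.aeval_derivative_ne_zero (minpoly.aeval _ _))

variable (k) in
/-- In a separable extension of transcendence degree `1`, any two differentials `db`, `dc` are
multiples of a third one. -/
theorem exists_D_mem_span_singleton [Algebra.IsGeometricallyReduced k E]
    (htr : Algebra.trdeg k E = 1) (b c : E) :
    ∃ t : Ω[E⁄k], KaehlerDifferential.D k E b ∈ Submodule.span E {t} ∧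
      KaehlerDifferential.D k E c ∈ Submodule.span E {t} := by
  -- The subfield `k(b, c)` is finitely generated and still geometrically reduced, so it has a
  -- separating transcendence basis, here with at most one element.
  let E₀ := IntermediateField.adjoin k ({b, c} : Set E)
  have : Algebra.IsGeometricallyReduced k E₀ :=
    Algebra.IsGeometricallyReduced.of_injective E₀.val E₀.val.injective
  have : Algebra.EssFiniteType k E₀ := by
    rw [IntermediateField.essFiniteType_iff]
    exact IntermediateField.fg_adjoin_of_finite (Set.toFinite _)
  obtain ⟨s, hs, hsep⟩ := exists_separating_transcendence_basis (k := k) (E := E₀)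
  have hcard : s.card ≤ 1 := by
    have h1 := hs.1.cardinalMk_le_trdeg
    have h2 : Algebra.trdeg k E₀ ≤ Algebra.trdeg k E :=
      trdeg_le_of_injective E₀.val E₀.val.injective
    have h3 := h1.trans (h2.trans htr.le)
    simpa using h3
  obtain ⟨t, ht⟩ : ∃ t : Ω[E⁄k], ∀ x ∈ s, KaehlerDifferential.D k E (x : E) ∈
      Submodule.span E {t} := by
    rcases Finset.card_le_one_iff_subset_singleton.1 hcard with ⟨x, hx⟩
    refine ⟨KaehlerDifferential.D k E x, fun y hy => ?_⟩
    rw [Finset.mem_singleton.1 (hx hy)]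
    exact Submodule.mem_span_singleton_self _
  refine ⟨t, ?_⟩
  let W := Submodule.span E {t}
  have : IsScalarTower k E₀ (Ω[E⁄k] ⧸ W) := ⟨fun a x m => smul_assoc a (x : E) m⟩
  -- The derivation `x ↦ dx` modulo `W` kills the separating basis, hence all of `E₀`.
  let δ : Derivation k E₀ (Ω[E⁄k] ⧸ W) :=
    { toFun := fun x => W.mkQ (KaehlerDifferential.D k E (x : E))
      map_add' := fun x y => by simp
      map_smul' := fun a x => by
        rw [IntermediateField.coe_smul, Derivation.map_smul]
        rfl
      map_one_eq_zero' := by simp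
      leibniz' := fun x y => by
        change W.mkQ (KaehlerDifferential.D k E ((x : E) * (y : E))) = _
        rw [Derivation.leibniz, map_add, map_smul, map_smul]
        rfl }
  have hδ : ∀ x : E₀, KaehlerDifferential.D k E (x : E) ∈ W := fun x =>
    (Submodule.Quotient.mk_eq_zero W).1 (derivation_eq_zero_of_isSeparable δ s
      (fun y hy => (Submodule.Quotient.mk_eq_zero W).2 (ht y hy)) x)
  exact ⟨hδ ⟨b, IntermediateField.subset_adjoin _ _ (by simp)⟩,
    hδ ⟨c, IntermediateField.subset_adjoin _ _ (by simp)⟩⟩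

variable (k E) in
-- Any nonzero `db` generates: each `dc` lies on a common line with it, and the `dc` span.
theorem exists_kaehlerDifferential_generator [Algebra.IsGeometricallyReduced k E]
    (htr : Algebra.trdeg k E = 1) [Nontrivial Ω[E⁄k]] :
    ∃ g : Ω[E⁄k], g ≠ 0 ∧ ∀ x, ∃ c : E, x = c • g := by
  obtain ⟨b, hb⟩ : ∃ b, KaehlerDifferential.D k E b ≠ 0 := by
    by_contra! h
    refine absurd (KaehlerDifferential.span_range_derivation k E) ?_
    rw [Submodule.span_eq_bot.2 (by rintro _ ⟨x, rfl⟩; exact h x)]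
    exact bot_ne_top
  refine ⟨_, hb, fun x => ?_⟩
  have hx : x ∈ Submodule.span E (Set.range (KaehlerDifferential.D k E)) := by
    rw [KaehlerDifferential.span_range_derivation]
    trivial
  suffices x ∈ Submodule.span E {KaehlerDifferential.D k E b} by
    obtain ⟨c, hc⟩ := Submodule.mem_span_singleton.1 this
    exact ⟨c, hc.symm⟩
  refine Submodule.span_le.2 ?_ hx
  rintro _ ⟨c, rfl⟩
  obtain ⟨t, h1, h2⟩ := exists_D_mem_span_singleton k htr b c
  obtain ⟨y, hy⟩ := Submodule.mem_span_singleton.1 h1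
  obtain ⟨z, hz⟩ := Submodule.mem_span_singleton.1 h2
  have hy0 : y ≠ 0 := by
    rintro rfl
    rw [zero_smul] at hy
    exact hb hy.symm
  refine Submodule.mem_span_singleton.2 ⟨z * y⁻¹, ?_⟩
  rw [← hy, smul_smul, mul_assoc, inv_mul_cancel₀ hy0, mul_one, hz]

end Separable

/-! ### The torsion as the kernel of the map to `Ω[L⁄K]`. -/

section Torsion

variable {K L : Type*} [Field K] [Field L] [Algebra K L]
variable (vK : AddValuation K (WithTop ℝ)) (vL : AddValuation L (WithTop ℝ))
variable [IsValuedExtension vK vL]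

instance isScalarTower_unitBall_field : IsScalarTower (unitBall vK) (unitBall vL) L :=
  IsScalarTower.of_algebraMap_eq fun _ => rfl

/-- An element in the kernel of `Ω_{L°/K°} → Ω_{L/K}` is torsion. -/
theorem exists_smul_eq_zero_of_kaehlerToField_eq_zero {x : Ω[unitBall vL⁄unitBall vK]}
    (hx : kaehlerToField vK vL x = 0) : ∃ s : nonZeroDivisors (unitBall vL), s • x = 0 := by
  -- The map factors through the differentials of `L` over `K°`: `f` is a localisation, and `g` is
  -- injective because `K` is a localisation of `K°` and so formally unramified over it.
  let f := KaehlerDifferential.map (unitBall vK) (unitBall vK) (unitBall vL) L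
  let g := KaehlerDifferential.map (unitBall vK) K L L
  have hfg : ∀ y, g (f y) = kaehlerToField vK vL y := by
    intro y
    have hy : y ∈ Submodule.span (unitBall vL) (Set.range
        (KaehlerDifferential.D (unitBall vK) (unitBall vL))) := by
      rw [KaehlerDifferential.span_range_derivation]
      trivial
    induction hy using Submodule.span_induction with
    | mem y hy =>
      obtain ⟨b, rfl⟩ := hy
      rw [kaehlerToField_D]
      simp only [f, g, KaehlerDifferential.map_D]
      rfl
    | zero => simp
    | add y z _ _ hy hz => rw [map_add, map_add, map_add, hy, hz]
    | smul a y _ hy =>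
      rw [map_smul f, map_smul (kaehlerToField vK vL), ← hy]
      exact map_smul g (a : L) (f y)
  have hg : Function.Injective g := by
    have : Algebra.FormallyUnramified (unitBall vK) K :=
      Algebra.FormallyUnramified.of_isLocalization (nonZeroDivisors (unitBall vK))
    have hex := KaehlerDifferential.exact_mapBaseChange_map (unitBall vK) K L
    rw [injective_iff_map_eq_zero]
    intro y hy
    obtain ⟨z, rfl⟩ := (hex y).1 hy
    rw [Subsingleton.elim z 0, map_zero]
  rw [← hfg] at hx
  exact (IsLocalizedModule.eq_zero_iff (nonZeroDivisors (unitBall vL)) f).1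
    (hg (hx.trans (map_zero g).symm))

/-- Every log differential becomes a differential after multiplication with a nonzero element. -/
theorem exists_smul_eq_mk_kaehler (ω : IntegralLogDifferentials vK vL) :
    ∃ (s : nonZeroDivisors (unitBall vL)) (x : Ω[unitBall vL⁄unitBall vK]),
      s • ω = (logRelations (unitBall vK) (unitBall vL) (nonZeroDivisors (unitBall vK))
        (nonZeroDivisors (unitBall vL))).mkQ (x, 0) := by
  set R := logRelations (unitBall vK) (unitBall vL) (nonZeroDivisors (unitBall vK))
    (nonZeroDivisors (unitBall vL))
  have key : ∀ c, ∃ (s : nonZeroDivisors (unitBall vL)) (x : Ω[unitBall vL⁄unitBall vK]),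
      s • R.mkQ (0, c) = R.mkQ (x, 0) := by
    intro c
    induction c using Finsupp.induction_linear with
    | zero => exact ⟨1, 0, by rw [one_smul]⟩
    | add c d hc hd =>
      obtain ⟨s, x, hs⟩ := hc
      obtain ⟨t, y, ht⟩ := hd
      refine ⟨t * s, t • x + s • y, ?_⟩
      have h1 : (0, c + d) = ((0, c) + (0, d) :
          Ω[unitBall vL⁄unitBall vK] × (nonZeroDivisors (unitBall vL) →₀ unitBall vL)) := by simp
      have h2 : (t • x + s • y, 0) = (t • (x, 0) + s • (y, 0) :
          Ω[unitBall vL⁄unitBall vK] × (nonZeroDivisors (unitBall vL) →₀ unitBall vL)) := by simp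
      simp only [Submonoid.smul_def] at *
      rw [h1, h2, map_add, map_add, map_smul, map_smul, ← hs, ← ht, smul_add, smul_smul, smul_smul,
        Submonoid.coe_mul, mul_comm (s : unitBall vL)]
    | single q b =>
      -- Multiplying by `q` works because `q dlog q = dq`.
      refine ⟨q, b • KaehlerDifferential.D _ _ (q : unitBall vL), ?_⟩
      rw [Submonoid.smul_def, ← map_smul, ← sub_eq_zero, ← map_sub, Submodule.mkQ_apply,
        Submodule.Quotient.mk_eq_zero]
      have h1 : (KaehlerDifferential.D (unitBall vK) (unitBall vL) (q : unitBall vL),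
          -Finsupp.single q (q : unitBall vL)) ∈ R :=
        Submodule.subset_span (.inl (.inl ⟨q, rfl⟩))
      convert R.smul_mem (-b) h1 using 1
      ext1
      · simp
      · simp [mul_comm]
  obtain ⟨⟨y, c⟩, rfl⟩ := R.mkQ_surjective ω
  obtain ⟨s, x, hs⟩ := key c
  refine ⟨s, s • y + x, ?_⟩
  have h1 : (y, c) = ((y, 0) + (0, c) :
      Ω[unitBall vL⁄unitBall vK] × (nonZeroDivisors (unitBall vL) →₀ unitBall vL)) := by simp
  have h2 : (s • y + x, 0) = (s • (y, 0) + (x, 0) :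
      Ω[unitBall vL⁄unitBall vK] × (nonZeroDivisors (unitBall vL) →₀ unitBall vL)) := by simp
  simp only [Submonoid.smul_def] at *
  rw [h1, h2, map_add, map_add, map_smul, ← hs, smul_add]

theorem toFieldDifferential_mkQ (x : Ω[unitBall vL⁄unitBall vK])
    (c : nonZeroDivisors (unitBall vL) →₀ unitBall vL) :
    toFieldDifferential vK vL ((logRelations (unitBall vK) (unitBall vL)
      (nonZeroDivisors (unitBall vK)) (nonZeroDivisors (unitBall vL))).mkQ (x, c)) =
      kaehlerToField vK vL x + Finsupp.linearCombination (unitBall vL)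
        (fun q : nonZeroDivisors (unitBall vL) =>
          (((q : unitBall vL) : L)⁻¹) • KaehlerDifferential.D K L ((q : unitBall vL) : L)) c :=
  rfl

theorem ball_smul_eq_zero {V : Type*} [AddCommGroup V] [Module L V] {a : unitBall vL} {x : V}
    (h : a • x = 0) : a = 0 ∨ x = 0 := by
  have h1 : (a : L) • x = 0 := h
  rcases smul_eq_zero.1 h1 with h2 | h2
  · exact .inl (Subtype.ext h2)
  · exact .inr h2

theorem mem_torsion_iff_toFieldDifferential_eq_zero (ω : IntegralLogDifferentials vK vL) :
    ω ∈ Submodule.torsion (unitBall vL) (IntegralLogDifferentials vK vL) ↔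
      toFieldDifferential vK vL ω = 0 := by
  constructor
  · rintro ⟨s, hs⟩
    have h1 : (s : unitBall vL) • toFieldDifferential vK vL ω = 0 := by
      rw [← map_smul, ← Submonoid.smul_def, hs, map_zero]
    exact (ball_smul_eq_zero vL h1).resolve_left (nonZeroDivisors.coe_ne_zero s)
  · intro h
    obtain ⟨s, x, hx⟩ := exists_smul_eq_mk_kaehler vK vL ω
    have h1 : kaehlerToField vK vL x = 0 := by
      have h2 := congrArg (toFieldDifferential vK vL) hx
      rwa [Submonoid.smul_def, map_smul, h, smul_zero, toFieldDifferential_mkQ, map_zero, add_zero,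
        eq_comm] at h2
    obtain ⟨t, ht⟩ := exists_smul_eq_zero_of_kaehlerToField_eq_zero vK vL h1
    refine ⟨t * s, ?_⟩
    rw [mul_smul, hx, Submonoid.smul_def, ← map_smul, Prod.smul_mk, ← Submonoid.smul_def, ht,
      smul_zero]
    exact map_zero _

end Torsion

/-! ### The Kähler valuation and the exact sequence for the log discrepancy. -/

section LogDiscrepancy

variable {K L : Type*} [Field K] [Field L] [Algebra K L]
variable (vK : AddValuation K (WithTop ℝ)) (vL : AddValuation L (WithTop ℝ))
variable [IsValuedExtension vK vL]

theorem inv_smul_D_mem_range_of_mem {b : L} (hb : b ∈ unitBall vL) (hb0 : b ≠ 0) :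
    b⁻¹ • KaehlerDifferential.D K L b ∈ LinearMap.range (toFieldDifferential vK vL) := by
  have hq : (⟨b, hb⟩ : unitBall vL) ∈ nonZeroDivisors (unitBall vL) :=
    mem_nonZeroDivisors_of_ne_zero fun h => hb0 (congrArg Subtype.val h)
  refine ⟨(logRelations (unitBall vK) (unitBall vL) (nonZeroDivisors (unitBall vK))
    (nonZeroDivisors (unitBall vL))).mkQ (0, Finsupp.single ⟨⟨b, hb⟩, hq⟩ 1), ?_⟩
  rw [toFieldDifferential_mkQ, map_zero, zero_add, Finsupp.linearCombination_single, one_smul]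

/-- Outside the unit ball, use `dlog b = -dlog b⁻¹`. -/
theorem inv_smul_D_mem_range {b : L} (hb0 : b ≠ 0) :
    b⁻¹ • KaehlerDifferential.D K L b ∈ LinearMap.range (toFieldDifferential vK vL) := by
  rcases (unitBall vL).mem_or_inv_mem b with hb | hb
  · exact inv_smul_D_mem_range_of_mem vK vL hb hb0
  · have h := neg_mem (inv_smul_D_mem_range_of_mem vK vL hb (inv_ne_zero hb0))
    convert h using 1
    rw [Derivation.leibniz_inv, smul_smul, inv_inv, ← neg_smul]
    congr 1
    field_simp

theorem IsSemivaluation.map_zero {M : Type*} [AddCommGroup M] [Module L M]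
    {vL : AddValuation L (WithTop ℝ)} {u : M → WithTop ℝ} (hu : IsSemivaluation vL u) :
    u 0 = ⊤ := by
  have h := hu.smul 0 0
  rwa [zero_smul, vL.map_zero, top_add] at h

/-- The elements with `u ≥ 0` form an `L°`-submodule. It contains `db` for `b ∈ L°`, and also `q⁻¹
dq`, since `u (q⁻¹ dq) ≥ -v q + v q = 0`. -/
theorem IsSemivaluation.nonneg_of_mem_range {vL : AddValuation L (WithTop ℝ)}
    [IsValuedExtension vK vL] {u : Ω[L⁄K] → WithTop ℝ}
    (hu : IsSemivaluation vL u) (hD : ∀ b : L, vL b ≤ u (KaehlerDifferential.D K L b))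
    {y : Ω[L⁄K]} (hy : y ∈ LinearMap.range (toFieldDifferential vK vL)) : 0 ≤ u y := by
  let U : Submodule (unitBall vL) Ω[L⁄K] :=
    { carrier := {y | 0 ≤ u y}
      add_mem' := fun {x y} hx hy => (le_min hx hy).trans (hu.min_le_add x y)
      zero_mem' := by
        change 0 ≤ u 0
        rw [hu.map_zero]
        exact le_top
      smul_mem' := fun a x hx => by
        change 0 ≤ u ((a : L) • x)
        rw [hu.smul]
        exact add_nonneg a.2 hx }
  obtain ⟨ω, rfl⟩ := hy
  obtain ⟨⟨x, c⟩, rfl⟩ := Submodule.mkQ_surjective _ ω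
  rw [toFieldDifferential_mkQ]
  refine add_mem (S := Submodule (unitBall vL) Ω[L⁄K]) (s := U) ?_ ?_
  · have hx : x ∈ Submodule.span (unitBall vL) (Set.range
        (KaehlerDifferential.D (unitBall vK) (unitBall vL))) := by
      rw [KaehlerDifferential.span_range_derivation]
      trivial
    induction hx using Submodule.span_induction with
    | mem x hx =>
      obtain ⟨b, rfl⟩ := hx
      rw [kaehlerToField_D]
      exact (show (0 : WithTop ℝ) ≤ vL (b : L) from b.2).trans (hD b)
    | zero => rw [_root_.map_zero]; exact zero_mem _
    | add x y _ _ hx hy => rw [map_add]; exact add_mem hx hy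
    | smul a x _ hx => rw [map_smul]; exact U.smul_mem a hx
  · rw [Finsupp.linearCombination_apply]
    refine sum_mem fun q _ => U.smul_mem _ ?_
    have hq : ((q : unitBall vL) : L) ≠ 0 := fun h =>
      nonZeroDivisors.coe_ne_zero q (Subtype.ext h)
    change 0 ≤ u (((q : unitBall vL) : L)⁻¹ • KaehlerDifferential.D K L ((q : unitBall vL) : L))
    rw [hu.smul]
    calc (0 : WithTop ℝ) = vL ((q : unitBall vL) : L)⁻¹ + vL ((q : unitBall vL) : L) := by
          rw [← vL.map_mul, inv_mul_cancel₀ hq, vL.map_one]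
      _ ≤ _ := by gcongr; exact hD _

theorem kaehlerValuation_zero : kaehlerValuation K vL (0 : Ω[L⁄K]) = ⊤ := by
  refine top_le_iff.1 (le_iInf₂ fun u hu => le_iInf fun _ => ?_)
  rw [hu.map_zero]
  rfl

/-- If `Ω_{L/K}` is one dimensional, the Kähler valuation of `g ≠ 0` is the supremum of the
valuations of the factors of `g` in the image of the log differentials. -/
theorem kaehlerValuation_eq_iSup {g : Ω[L⁄K]} (hg : g ≠ 0) (hgen : ∀ x, ∃ c : L, x = c • g)
    (hgJ : g ∈ LinearMap.range (toFieldDifferential vK vL)) :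
    kaehlerValuation K vL g =
      ((⨆ (y : LinearMap.range (toFieldDifferential vK vL)) (a : unitBall vL)
        (_ : (⟨g, hgJ⟩ : LinearMap.range (toFieldDifferential vK vL)) = a • y),
        ballVal vL a : ℝ≥0∞) : EReal) := by
  set C := ⨆ (y : LinearMap.range (toFieldDifferential vK vL)) (a : unitBall vL)
        (_ : (⟨g, hgJ⟩ : LinearMap.range (toFieldDifferential vK vL)) = a • y),
        ballVal vL a
  refine le_antisymm ?_ (le_iInf₂ fun u hu => le_iInf fun hD => ?_)
  · by_cases htop : C = ⊤
    · rw [htop]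
      exact le_top
    obtain ⟨r, hr⟩ : ∃ r : ℝ, (C : EReal) = r :=
      ⟨C.toReal, by rw [← EReal.coe_ennreal_toReal htop]⟩
    choose c hc using hgen
    have huniq : ∀ (x : Ω[L⁄K]) (d : L), x = d • g → c x = d := fun x d hx =>
      smul_left_injective L hg ((hc x).symm.trans hx)
    -- The semivaluation on the line normalised to take the value `C` at `g`; it bounds the infimum
    -- once it is shown to be admissible.
    have hu : IsSemivaluation vL fun x => vL (c x) + (r : WithTop ℝ) := by
      refine ⟨fun x y => ?_, fun d x => ?_⟩
      · rw [huniq (x + y) (c x + c y) (by rw [add_smul, ← hc, ← hc]), min_add_add_right]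
        gcongr
        exact vL.map_add _ _
      · rw [huniq (d • x) (d * c x) (by rw [mul_smul, ← hc]), vL.map_mul, add_assoc]
    have hr0 : 0 ≤ r := by
      rw [← EReal.coe_nonneg, ← hr]
      exact EReal.coe_ennreal_nonneg _
    refine (iInf₂_le_of_le _ hu (iInf_le_of_le (fun b => ?_) le_rfl)).trans ?_
    · by_cases hcb : c (KaehlerDifferential.D K L b) = 0
      · simp [hcb]
      set d := c (KaehlerDifferential.D K L b) with hd
      have hb : b ≠ 0 := by
        rintro rfl
        exact hcb (huniq _ 0 (by simp))
      -- With `db = d • g` one has `g = (b / d) • (b⁻¹ • db)`, so `b / d`, if integral, is one of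
      -- the factors counted by `C`; otherwise its valuation is at most `0 ≤ r`.
      have hbd : vL (b / d) ≤ (r : WithTop ℝ) := by
        rcases le_total 0 (vL (b / d)) with h | h
        · have h1 := inv_smul_D_mem_range vK vL hb
          have h2 : ballVal vL ⟨b / d, h⟩ ≤ C := by
            refine le_iSup₂_of_le ⟨_, h1⟩ ⟨b / d, h⟩ (le_iSup_of_le (Subtype.ext ?_) le_rfl)
            change g = (b / d) • (b⁻¹ • KaehlerDifferential.D K L b)
            rw [hc (KaehlerDifferential.D K L b), ← hd, smul_smul, smul_smul]
            rw [show b / d * b⁻¹ * d = 1 by field_simp, one_smul]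
          rw [← EReal.coe_ennreal_le_coe_ennreal_iff, coe_ballVal, hr, ← toEReal_coe,
            toEReal_le_toEReal] at h2
          exact h2
        · exact h.trans (by exact_mod_cast hr0)
      calc vL b = vL d + vL (b / d) := by rw [← vL.map_mul, mul_div_cancel₀ _ hcb]
        _ ≤ _ := add_le_add le_rfl hbd
    · change toEReal (vL (c g) + r) ≤ _
      rw [huniq g 1 (by rw [one_smul]), vL.map_one, zero_add, hr, toEReal_coe]
  -- An admissible `u` is nonnegative on the image, so `g = a • y` forces `u g = v a + u y ≥ v a`.
  · have hu0 : 0 ≤ u g := hu.nonneg_of_mem_range vK hD hgJ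
    rw [← EReal.coe_toENNReal (toEReal_nonneg hu0), EReal.coe_ennreal_le_coe_ennreal_iff]
    refine iSup₂_le fun y a => iSup_le fun h => ?_
    rw [← EReal.coe_ennreal_le_coe_ennreal_iff, EReal.coe_toENNReal (toEReal_nonneg hu0),
      coe_ballVal, toEReal_le_toEReal]
    have h1 : g = (a : L) • (y : Ω[L⁄K]) := congrArg Subtype.val h
    rw [h1, hu.smul]
    exact le_add_of_nonneg_right (hu.nonneg_of_mem_range vK hD y.2)

theorem exists_toFieldDifferential_ne_zero [Nontrivial Ω[L⁄K]] :
    ∃ m, toFieldDifferential vK vL m ≠ 0 := by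
  by_contra! h
  refine absurd (KaehlerDifferential.span_range_derivation K L) ?_
  rw [Submodule.span_eq_bot.2]
  · exact bot_ne_top
  rintro _ ⟨b, rfl⟩
  by_cases hb : b = 0
  · rw [hb, map_zero]
  obtain ⟨m, hm⟩ := inv_smul_D_mem_range vK vL hb
  rw [h, eq_comm, smul_eq_zero] at hm
  exact hm.resolve_left (inv_ne_zero hb)

/-- Choose `m` with `m_L ≠ 0`. If `a • m ∈ L°ω`, then `a • m_L = 0` and `a = 0`; the class of `m`
thus has zero annihilator. -/
theorem valLength_quotient_of_toFieldDifferential_eq_zero [Nontrivial Ω[L⁄K]]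
    {ω : IntegralLogDifferentials vK vL} (hω : toFieldDifferential vK vL ω = 0) :
    valLength vL (IntegralLogDifferentials vK vL ⧸ Submodule.span (unitBall vL) {ω}) = ⊤ := by
  obtain ⟨m, hm⟩ := exists_toFieldDifferential_ne_zero vK vL
  refine valLength_eq_top (x := Submodule.mkQ _ m) fun a ha => ?_
  rw [← map_smul, Submodule.mkQ_apply, Submodule.Quotient.mk_eq_zero] at ha
  obtain ⟨b, hb⟩ := Submodule.mem_span_singleton.1 ha
  have h1 := congrArg (toFieldDifferential vK vL) hb
  rw [map_smul, map_smul, hω, smul_zero] at h1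
  exact (ball_smul_eq_zero vL h1.symm).resolve_right hm

/-- Additivity along `0 → Ω_tor → Ω / L°ω → J / L°ω_L → 0`, where `J` is the image of the log
differentials in `Ω_{L/K}`. -/
theorem valLength_quotient_eq_add {ω : IntegralLogDifferentials vK vL}
    (hω : toFieldDifferential vK vL ω ≠ 0) :
    valLength vL (IntegralLogDifferentials vK vL ⧸ Submodule.span (unitBall vL) {ω}) =
      valLength vL (Submodule.torsion (unitBall vL) (IntegralLogDifferentials vK vL)) +
      relLength vL (Submodule.span (unitBall vL) {(toFieldDifferential vK vL).rangeRestrict ω}) := by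
  set φ := toFieldDifferential vK vL
  set T := Submodule.torsion (unitBall vL) (IntegralLogDifferentials vK vL)
  set N := Submodule.span (unitBall vL) {ω}
  set N' := Submodule.span (unitBall vL) {φ.rangeRestrict ω}
  have hN : N.map φ.rangeRestrict = N' := by
    rw [Submodule.map_span, Set.image_singleton]
  rw [← valLength_quotient]
  refine valLength_eq_add (N.mkQ.comp T.subtype)
    (N.mapQ N' φ.rangeRestrict (Submodule.map_le_iff_le_comap.1 hN.le)) ?_ ?_ ?_
  · rw [injective_iff_map_eq_zero]
    intro t ht
    obtain ⟨a, ha⟩ := Submodule.mem_span_singleton.1 ((Submodule.Quotient.mk_eq_zero N).1 ht)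
    -- A torsion element `a • ω` satisfies `a • ω_L = 0`, hence `a = 0`: the torsion meets `L°ω`
    -- trivially.
    have h1 : φ (t : IntegralLogDifferentials vK vL) = 0 :=
      (mem_torsion_iff_toFieldDifferential_eq_zero vK vL _).1 t.2
    change a • ω = (t : IntegralLogDifferentials vK vL) at ha
    rw [← ha, map_smul] at h1
    rw [(ball_smul_eq_zero vL h1).resolve_right hω, zero_smul] at ha
    exact Subtype.ext ha.symm
  · intro y
    obtain ⟨y, rfl⟩ := N'.mkQ_surjective y
    obtain ⟨x, rfl⟩ := φ.surjective_rangeRestrict y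
    exact ⟨N.mkQ x, rfl⟩
  · intro x
    obtain ⟨x, rfl⟩ := N.mkQ_surjective x
    constructor
    · intro hx
      have h1 : φ.rangeRestrict x ∈ N' := (Submodule.Quotient.mk_eq_zero N').1 hx
      obtain ⟨a, ha⟩ := Submodule.mem_span_singleton.1 h1
      -- Exactness in the middle: if `x_L = a • ω_L`, then `x - a • ω` is a torsion element with the
      -- same class as `x`.
      have h2 : φ (x - a • ω) = 0 := by
        rw [map_sub, map_smul, sub_eq_zero]
        exact (congrArg Subtype.val ha).symm
      refine ⟨⟨x - a • ω, (mem_torsion_iff_toFieldDifferential_eq_zero vK vL _).2 h2⟩, ?_⟩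
      refine (Submodule.Quotient.eq N).2 ?_
      rw [Submodule.subtype_apply, sub_sub_cancel_left]
      exact neg_mem (Submodule.smul_mem _ _ (Submodule.mem_span_singleton_self ω))
    · rintro ⟨t, ht⟩
      rw [← ht]
      refine (Submodule.Quotient.mk_eq_zero N').2 ?_
      have h1 : φ.rangeRestrict (t : IntegralLogDifferentials vK vL) = 0 :=
        Subtype.ext ((mem_torsion_iff_toFieldDifferential_eq_zero vK vL _).1 t.2)
      rw [Submodule.subtype_apply, h1]
      exact zero_mem _

end LogDiscrepancy

end LogDiff

end

/-! ### The discrepancy formula. -/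

theorem mainTheorem11 {K L : Type*} [Field K] [Field L] [Algebra K L]
    (vK : AddValuation K (WithTop ℝ)) (vL : AddValuation L (WithTop ℝ))
    [LogDiff.IsValuedExtension vK vL]
    (hsep : Algebra.IsGeometricallyReduced K L) (htr : Algebra.trdeg K L = 1)
    (hΩ : Nontrivial Ω[L⁄K])
    (ω : LogDiff.IntegralLogDifferentials vK vL) :
    LogDiff.logDiscrepancy vK vL ω =
      LogDiff.kaehlerValuation K vL (LogDiff.toFieldDifferential vK vL ω) +
        LogDiff.absLogDifferent vK vL := by
  rw [LogDiff.logDiscrepancy, LogDiff.absLogDifferent, if_pos hsep,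
    LogDiff.content_eq_valLength, LogDiff.content_eq_valLength]
  by_cases hω : LogDiff.toFieldDifferential vK vL ω = 0
  · rw [LogDiff.valLength_quotient_of_toFieldDifferential_eq_zero vK vL hω, hω,
      LogDiff.kaehlerValuation_zero, EReal.coe_ennreal_top,
      EReal.top_add_of_ne_bot (EReal.coe_ennreal_ne_bot _)]
  obtain ⟨g, hg, hgen⟩ := LogDiff.exists_kaehlerDifferential_generator K L htr
  have hgen' : ∀ x, ∃ c : L, x = c • LogDiff.toFieldDifferential vK vL ω := by
    intro x
    obtain ⟨c, rfl⟩ := hgen x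
    obtain ⟨d, hd⟩ := hgen (LogDiff.toFieldDifferential vK vL ω)
    have hd0 : d ≠ 0 := by
      rintro rfl
      exact hω (by rw [hd, zero_smul])
    exact ⟨c / d, by rw [hd, smul_smul, div_mul_cancel₀ _ hd0]⟩
  rw [LogDiff.valLength_quotient_eq_add vK vL hω,
    LogDiff.kaehlerValuation_eq_iSup vK vL hω hgen' ⟨ω, rfl⟩, EReal.coe_ennreal_add, add_comm,
    LogDiff.relLength_span_singleton]
  · rfl
  -- On a line, two nonzero vectors have a ratio in `L`, and either it or its inverse lies in the
  -- unit ball.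
  · rintro ⟨x, hx⟩ ⟨y, hy⟩
    obtain ⟨c, rfl⟩ := hgen x
    obtain ⟨d, rfl⟩ := hgen y
    by_cases hd : d = 0
    · exact .inr ⟨0, Subtype.ext (by simp [hd])⟩
    by_cases hc : c = 0
    · exact .inl ⟨0, Subtype.ext (by simp [hc])⟩
    rcases (LogDiff.unitBall vL).mem_or_inv_mem (c / d) with h | h
    · refine .inl ⟨⟨c / d, h⟩, Subtype.ext ?_⟩
      change c • g = (c / d) • d • g
      rw [smul_smul, div_mul_cancel₀ _ hd]
    · refine .inr ⟨⟨(c / d)⁻¹, h⟩, Subtype.ext ?_⟩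
      change d • g = (c / d)⁻¹ • c • g
      rw [smul_smul, inv_div, div_mul_cancel₀ _ hc]
  · rintro a x h
    rcases LogDiff.ball_smul_eq_zero vL (congrArg Subtype.val h) with h | h
    · exact .inl h
    · exact .inr (Subtype.ext h)
  · exact fun h => hω (congrArg Subtype.val h)
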